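/- Notation. Sequences are finite and ordered by extension ($s\preceq t$ if $s$ is an initial segment of $t$); $MAX(T)$ is the set of maximal members of a set $T$ of sequences, $T'=T\setminus MAX(T)$, and $T^\alpha$ ($\alpha$ an ordinal) are the iterated derivatives of $T$, with intersections at limit ordinals. A $B$-tree is a set $B$ of non-empty sequences that is closed under non-empty initial segments; $o(B)$ is the least $\alpha$ with $B^\alpha=\varnothing$. If $X$ is a Banach space, $(x_t)_{t\in B}\subset X$ is weakly null if for every ordinal $\alpha$ and every $t\in (B\cup\{\varnothing\})^{\alpha+1}$, $0$ is in the weak closure of the set of all $x_s$ with $s\in B^\alpha$ an immediate successor of $t$. For a bounded linear operator $A:X\to Y$, a norm $|\cdot|$ on $Y$, an ordinal $\xi$ and $\sigma>0$, put $$\rho_\xi(\sigma;A:X\to(Y,|\cdot|))=\sup\ \inf\{|y+Ax|-1: t\in B,\ x\in \mathrm{co}(x_s:s\preceq t)\},$$ the supremum being over all $y$ with $|y|\le 1$, all $B$-trees $B$ with $o(B)=\omega^\xi$ and all weakly null $(x_t)_{t\in B}\subset\sigma B_X$. Special trees. Let $\beta+s$ denote the sequence $s$ of ordinals with $\beta$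 added on the left to each term. Let $\Gamma_0=\{(0)\}$; $\Gamma_{\xi,1}=\Gamma_\xi$; $\Gamma_{\xi,n+1}=(\omega^\xi n+\Gamma_\xi)\cup\{t^\frown u: t\in MAX(\omega^\xi n+\Gamma_\xi),\ u\in\Gamma_{\xi,n}\}$; $\Gamma_{\xi+1}=\bigcup_{n\ge1}\Gamma_{\xi,n}$; and $\Gamma_\xi=\bigcup_{\zeta<\xi}(\omega^\zeta+\Gamma_{\zeta+1})$ for limit $\xi$. A member $s$ of $\Gamma_{\xi,n}$ is on level $i$ ($1\le i\le n$) if its last term is in $[\omega^\xi(n-i),\omega^\xi(n-i+1))$; then $s=r^\frown(\omega^\xi(n-i)+u)$ with $u\in\Gamma_\xi$ and with $r$ empty or a maximal member of level $i-1$, and $\iota_{\xi,n}(s)=u$. Weights on $\Gamma_\xi$ are given by $\mathbb P_0=1$; $\mathbb P_{\xi+1}(s)=\frac1n\mathbb P_\xi(\iota_{\xi,n}(s))$ for $s\in\Gamma_{\xi,n}$; and $\mathbb P_\xi(\omega^\zeta+s)=\mathbb P_{\zeta+1}(s)$ for limit $\xi$, $\zeta<\xi$ and $s\in\Gamma_{\zeta+1}$.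 Let $D$ be a basis of neighborhoods of $0$ in the weak topology of $X$, and let $\Omega_{\xi,n}$ be the set of all $t=(\zeta_i,U_i)_{i=1}^k$ with $(\zeta_i)_{i=1}^k\in\Gamma_{\xi,n}$ and $U_i\in D$; levels, $\iota_{\xi,n}$ and $\mathbb P_\xi$ are applied to $t$ through $(\zeta_i)_i$. A collection $(x_t)_{t\in\Omega_{\xi,n}}\subset X$ is normally weakly null if $x_t\in U$ whenever the last term of $t$ is $(\zeta,U)$. For $t\in MAX(\Omega_{\xi,n})$ and $1\le i\le n$ let $z_i^t=\sum \mathbb P_\xi(\iota_{\xi,n}(s))x_s$, summed over the $s\preceq t$ on level $i$. Let $N_\xi(\sigma)$ be the smallest integer $N\ge0$ for which there is a normally weakly null $(x_t)_{t\in\Omega_{\xi,N+1}}\subset\sigma B_X$ with $\|\sum_{i=1}^{N+1}Az_i^t\|>1$ for every $t\in MAX(\Omega_{\xi,N+1})$, and $N_\xi(\sigma)=\infty$ if there is none. Let $\varrho_\xi(y,0,\sigma)=\|y\|$ and, for $n\ge1$, let $\varrho_\xi(y,n,\sigma)$ be the infimum of all $\lambda\in\mathbb R$ such that for every normally weakly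 null $(x_t)_{t\in\Omega_{\xi,n}}\subset\sigma B_X$ there is $t\in MAX(\Omega_{\xi,n})$ with $\|y+\sum_{i=1}^nAz_i^t\|\le\lambda$. Theorem. Let $X,Y$ be real or complex Banach spaces, $\xi$ an ordinal, $A:X\to Y$ a linear operator with $\|A\|\le1$, and $0<\sigma\le1$. (i) If $N=N_\xi(\sigma)<\infty$, then $N\ge1$ and there is a norm $|\cdot|$ on $Y$ with $|y|\le\|y\|\le2|y|$ for all $y\in Y$ (a $2$-equivalent norm), with closed unit ball $$\{y\in Y:|y|\le1\}=\Bigl\{y\in Y:\frac1N\sum_{n=0}^{N-1}\varrho_\xi(y,n,\sigma)\le2\Bigr\},$$ such that $\rho_\xi(\sigma;A:X\to(Y,|\cdot|))\le 1/N$. (ii) If $N_\xi(\sigma)=\infty$, then for every integer $N\ge1$ there is a norm $|\cdot|$ on $Y$ with the same properties for this $N$. -/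

import Mathlib

open scoped Topology

universe u v w u' u''

noncomputable section

namespace XiAUS

/-! Trees of finite sequences are sets of lists; `s <+: t` says that `s` is an initial segment
of `t` (possibly `s = t`). -/

section Trees

variable {Λ : Type w}

/-- The members of `T` that have no proper extension in `T`. -/
def maxElems (T : Set (List Λ)) : Set (List Λ) :=
  {t | t ∈ T ∧ ∀ s ∈ T, t <+: s → s = t}

/-- A `B`-tree: a set of non-empty finite sequences closed under non-empty initial segments. -/
def IsBTree (B : Set (List Λ)) : Prop :=
  [] ∉ B ∧ ∀ t ∈ B, ∀ s : List Λ, s ≠ [] → s <+: t → s ∈ B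

/-- The transfinite derivatives of `T`: at each step the maximal members are removed. -/
def deriv (T : Set (List Λ)) (α : Ordinal.{v}) : Set (List Λ) :=
  Ordinal.limitRecOn (motive := fun _ => Set (List Λ)) α T
    (fun _ S => S \ maxElems S)
    (fun β _ S => ⋂ (γ : Ordinal.{v}) (h : γ < β), S γ h)

/-- `T` is well-founded and its order `o(T)` is `α`. -/
def HasOrder (T : Set (List Λ)) (α : Ordinal.{v}) : Prop :=
  IsLeast {β : Ordinal.{v} | deriv T β = ∅} α

end Trees

section Modulus

variable (𝕜 : Type u') [RCLike 𝕜]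
variable {X : Type u} [NormedAddCommGroup X] [NormedSpace 𝕜 X] [NormedSpace ℝ X]
variable {Y : Type u''} [NormedAddCommGroup Y] [NormedSpace 𝕜 Y]

/-- `(x_t)_{t ∈ B}` is weakly null: for every ordinal `α` and every `t ∈ (B ∪ {∅})^(α+1)`, `0` is
in the weak closure of the set of all `x_s` with `s ∈ B^α` an immediate successor of `t`.
(The derivatives of a `B`-tree of order `o(B) : Ordinal.{v}` are empty from `o(B)` on, so that
the ordinals of the universe of `o(B)` suffice.) -/
def IsWeaklyNull {Λ : Type w} (B : Set (List Λ)) (x : List Λ → X) : Prop :=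
  ∀ (α : Ordinal.{v}) (t : List Λ), t ∈ deriv (insert [] B) (α + 1) →
    (0 : WeakSpace 𝕜 X) ∈
      closure (toWeakSpace 𝕜 X '' (x '' {s | s ∈ deriv B α ∧ ∃ a : Λ, s = t ++ [a]}))

variable {𝕜}

/-- The modulus `ρ_ξ(σ; A : X → (Y, p))` of `ξ`-asymptotic uniform smoothness, where `p` is a norm
on `Y`, as an extended real number: the supremum over all `y` in the unit ball of `p`, all
`B`-trees `B` with `o(B) = ω ^ ξ` on sets `Λ : Type w`, and all weakly null collections
`(x_t)_{t ∈ B}` in `σ B_X`, of the infimum of `p (y + A z) - 1` over all `t ∈ B` and all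
`z` in the convex hull of `{x_s : s ⪯ t}`. -/
def rho (ξ : Ordinal.{v}) (σ : ℝ) (A : X →L[𝕜] Y) (p : Seminorm 𝕜 Y) : EReal :=
  ⨆ (y : Y) (_ : p y ≤ 1) (Λ : Type w) (B : Set (List Λ)) (_ : IsBTree B)
    (_ : HasOrder B (Ordinal.omega0 ^ ξ)) (x : List Λ → X) (_ : ∀ t ∈ B, ‖x t‖ ≤ σ)
    (_ : IsWeaklyNull.{u, v, w} 𝕜 B x),
    ⨅ (t ∈ B) (z ∈ convexHull ℝ (x '' {s | s ∈ B ∧ s <+: t})), ((p (y + A z) - 1 : ℝ) : EReal)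

end Modulus

section SpecialTrees

/-- `β + G = {β + s : s ∈ G}`, where `β` is added on the left to each term of `s`. -/
def shift (β : Ordinal.{v}) (G : Set (List Ordinal.{v})) : Set (List Ordinal.{v}) :=
  (fun s => s.map (fun a => β + a)) '' G

/-- `n` levels of copies of `G`: a copy of `α * n + G`, and below each of its maximal members a
copy of the tree with one level less. -/
def levels (α : Ordinal.{v}) (G : Set (List Ordinal.{v})) : ℕ → Set (List Ordinal.{v})
  | 0 => ∅
  | n + 1 => shift (α * n) G ∪
      {r | ∃ t ∈ maxElems (shift (α * n) G), ∃ s ∈ levels α G n, r = t ++ s}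

/-- The `B`-tree `Γ_ξ` on `[0, ω ^ ξ)`: `Γ_0 = {(0)}`, `Γ_(ξ+1)` is the union of the trees
`Γ_{ξ,n}` with `n ≥ 1` levels, and `Γ_ξ` is the union of the trees `ω ^ ζ + Γ_(ζ+1)`, `ζ < ξ`, for
limit `ξ`. -/
def Gam (ξ : Ordinal.{v}) : Set (List Ordinal.{v}) :=
  Ordinal.limitRecOn (motive := fun _ => Set (List Ordinal.{v})) ξ {[0]}
    (fun ξ G => ⋃ n : ℕ, levels (Ordinal.omega0 ^ ξ) G (n + 1))
    (fun ξ hξ G => ⋃ (ζ : Ordinal.{v}) (h : ζ < ξ),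
      shift (Ordinal.omega0 ^ ζ) (G (ζ + 1) (hξ.add_one_lt h)))

/-- The tree `Γ_{ξ,n}`. -/
def GamN (ξ : Ordinal.{v}) (n : ℕ) : Set (List Ordinal.{v}) :=
  levels (Ordinal.omega0 ^ ξ) (Gam ξ) n

/-- The map `ι_{ξ,n}`, which sends a member of `Γ_{ξ,n}` to the member of `Γ_ξ` that corresponds to
it in its unit. The last term of `s` has the form `ω ^ ξ * k + b` with `b < ω ^ ξ`; the part of `s`
in the last unit consists of the terms with the same `k`, from which `ω ^ ξ * k` is removed. -/
def iota (ξ : Ordinal.{v}) (s : List Ordinal.{v}) : List Ordinal.{v} :=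
  open Classical in
  (s.filter (fun a => a / Ordinal.omega0 ^ ξ = s.getLastD 0 / Ordinal.omega0 ^ ξ)).map
    (fun a => a % Ordinal.omega0 ^ ξ)

/-- The weights `ℙ_ξ` on `Γ_ξ` (junk outside `Γ_ξ`). `ℙ_0 = 1`. On `Γ_{ξ,n}`, a part of `Γ_(ξ+1)`,
`ℙ_(ξ+1) = ℙ_ξ ∘ ι_{ξ,n} / n`; here `n - 1` is the quotient by `ω ^ ξ` of the first term. For a
limit ordinal `ξ` and `t = ω ^ ζ + t'` with `t' ∈ Γ_(ζ+1)`, `ℙ_ξ(t) = ℙ_(ζ+1)(t')`; here `ζ` is the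
logarithm to base `ω` of the first term. -/
def weight (ξ : Ordinal.{v}) : List Ordinal.{v} → ℝ :=
  open Classical in
  Ordinal.limitRecOn (motive := fun _ => List Ordinal.{v} → ℝ) ξ (fun _ => 1)
    (fun ξ P t =>
      P (iota ξ t) / ((Cardinal.toNat (t.headD 0 / Ordinal.omega0 ^ ξ).card : ℝ) + 1))
    (fun ξ hξ P t =>
      if h : Ordinal.log Ordinal.omega0 (t.headD 0) < ξ then
        P (Ordinal.log Ordinal.omega0 (t.headD 0) + 1) (hξ.add_one_lt h)
          (t.map (fun a => a - Ordinal.omega0 ^ Ordinal.log Ordinal.omega0 (t.headD 0)))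
      else 0)

end SpecialTrees

section NormallyWeaklyNull

variable {X : Type u}

/-- `Ω_{ξ,n} = Γ_{ξ,n} D`: sequences of pairs with first terms forming a member of `Γ_{ξ,n}` and
second terms in `D`. -/
def Om (ξ : Ordinal.{v}) (D : Set (Set X)) (n : ℕ) : Set (List (Ordinal.{v} × Set X)) :=
  {t | t.map Prod.fst ∈ GamN ξ n ∧ ∀ a ∈ t, a.2 ∈ D}

/-- `D` is a basis of the neighbourhoods of `0` in the weak topology of `X`. -/
def IsWeakNhdsBasis (𝕜 : Type u') [RCLike 𝕜] [NormedAddCommGroup X] [NormedSpace 𝕜 X]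
    (D : Set (Set X)) : Prop :=
  ((𝓝 (0 : WeakSpace 𝕜 X)).comap (toWeakSpace 𝕜 X)).HasBasis (fun U : Set X => U ∈ D) id

/-- `(x_t)_{t ∈ Ω_{ξ,n}}` is normally weakly null: `x_t ∈ U` if `(ζ, U)` is the last term
of `t`. -/
def IsNormallyWeaklyNull (ξ : Ordinal.{v}) (D : Set (Set X)) (n : ℕ)
    (x : List (Ordinal.{v} × Set X) → X) : Prop :=
  ∀ t a, t ++ [a] ∈ Om ξ D n → x (t ++ [a]) ∈ a.2

/-- The special convex block `z_i^t`, `1 ≤ i ≤ n`: the sum of `ℙ_ξ(ι_{ξ,n}(s)) x_s` over the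
non-empty initial segments `s = t.take (k + 1)` of `t` on level `i`, i.e. those whose last term lies
in `[ω ^ ξ * (n - i), ω ^ ξ * (n - i + 1))`. -/
def block [AddCommGroup X] [Module ℝ X] (ξ : Ordinal.{v}) (n : ℕ)
    (x : List (Ordinal.{v} × Set X) → X) (t : List (Ordinal.{v} × Set X)) (i : ℕ) : X :=
  open Classical in
  ∑ k ∈ (Finset.range t.length).filter (fun k =>
      ((t.take (k + 1)).map Prod.fst).getLastD 0 / Ordinal.omega0 ^ ξ = ((n - i : ℕ) : Ordinal.{v})),
    weight ξ (iota ξ ((t.take (k + 1)).map Prod.fst)) • x (t.take (k + 1))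

variable {𝕜 : Type u'} [RCLike 𝕜] [NormedAddCommGroup X] [NormedSpace 𝕜 X] [NormedSpace ℝ X]
variable {Y : Type u''} [NormedAddCommGroup Y] [NormedSpace 𝕜 Y]

/-- `N_ξ(σ; A)`: the smallest `N` for which there is a normally weakly null collection
`(x_t)_{t ∈ Ω_{ξ,N+1}}` in `σ B_X` such that `‖∑_{i=1}^{N+1} A z_i^t‖ > 1` for all maximal `t`; it
is `⊤` if there is no such `N`. -/
def enN (ξ : Ordinal.{v}) (σ : ℝ) (A : X →L[𝕜] Y) (D : Set (Set X)) : ℕ∞ :=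
  ⨅ (N : ℕ) (_ : ∃ x : List (Ordinal.{v} × Set X) → X,
      IsNormallyWeaklyNull ξ D (N + 1) x ∧ (∀ t ∈ Om ξ D (N + 1), ‖x t‖ ≤ σ) ∧
      ∀ t ∈ maxElems (Om ξ D (N + 1)),
        1 < ‖∑ i ∈ Finset.Icc 1 (N + 1), A (block ξ (N + 1) x t i)‖), (N : ℕ∞)

/-- `ϱ_ξ(y, n, σ)`: `‖y‖` for `n = 0`, and for `n ≥ 1` the infimum of all `l` such that every
normally weakly null collection `(x_t)_{t ∈ Ω_{ξ,n}}` in `σ B_X` admits a maximal `t` with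
`‖y + ∑_{i=1}^n A z_i^t‖ ≤ l`. -/
def varrho (ξ : Ordinal.{v}) (σ : ℝ) (A : X →L[𝕜] Y) (D : Set (Set X)) (y : Y) (n : ℕ) : ℝ :=
  if n = 0 then ‖y‖ else
    sInf {l : ℝ | ∀ x : List (Ordinal.{v} × Set X) → X,
      IsNormallyWeaklyNull ξ D n x → (∀ t ∈ Om ξ D n, ‖x t‖ ≤ σ) →
      ∃ t ∈ maxElems (Om ξ D n), ‖y + ∑ i ∈ Finset.Icc 1 n, A (block ξ n x t i)‖ ≤ l}

end NormallyWeaklyNull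

/-- `p` is a norm on `Y` with `|y| ≤ ‖y‖ ≤ 2 |y|` for all `y`. -/
def IsTwoEquivalentNorm {𝕜 : Type u'} [RCLike 𝕜] {Y : Type u''} [NormedAddCommGroup Y]
    [NormedSpace 𝕜 Y] (p : Seminorm 𝕜 Y) : Prop :=
  ∀ y : Y, p y ≤ ‖y‖ ∧ ‖y‖ ≤ 2 * p y

end XiAUS

end

noncomputable section

namespace XiAUS

/-! ### Runs, and strategies as quantifiers on runs. -/

section Strategies

variable {X : Type u}

/-- The vectors that occur in a run, a list of weighted vectors. -/
def el (r : List (ℝ × X)) : Set X := {x | ∃ p ∈ r, p.2 = x}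

/-- The weighted sum of the values of `h` along a run. -/
def wsum (r : List (ℝ × X)) (h : X → ℝ) : ℝ := (r.map fun p => p.1 * h p.2).sum

/-- All weights of a run divided by `n + 1`. -/
def scale (n : ℕ) (r : List (ℝ × X)) : List (ℝ × X) := r.map fun p => (p.1 / ((n : ℝ) + 1), p.2)

/-- `n` nested applications of a quantifier on runs, the runs being concatenated. -/
def iter (Q : (List (ℝ × X) → Prop) → Prop) : ℕ → (List (ℝ × X) → Prop) → Prop
  | 0, Φ => Φ []
  | n + 1, Φ => Q fun r => iter Q n fun r' => Φ (r ++ r')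

/-- The quantifier "there is a collection indexed by the tree of order `ω ^ ξ`, subject to the
filter `F`, such that the runs along all branches satisfy `Φ`". -/
def Strat (F : Filter X) (ξ : Ordinal.{v}) : (List (ℝ × X) → Prop) → Prop :=
  Ordinal.limitRecOn (motive := fun _ => (List (ℝ × X) → Prop) → Prop) ξ
    (fun Φ => ∃ᶠ x in F, Φ [(1, x)])
    (fun _ Q Φ => ∀ n : ℕ, iter Q (n + 1) fun r => Φ (scale n r))
    (fun ξ hξ Q Φ => ∀ (ζ : Ordinal.{v}) (h : ζ < ξ), Q (ζ + 1) (hξ.add_one_lt h) Φ)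

theorem strat_zero (F : Filter X) (Φ : List (ℝ × X) → Prop) :
    Strat F (0 : Ordinal.{v}) Φ ↔ ∃ᶠ x in F, Φ [(1, x)] := by
  rw [Strat, Ordinal.limitRecOn_zero]

theorem strat_add_one (F : Filter X) (ξ : Ordinal.{v}) (Φ : List (ℝ × X) → Prop) :
    Strat F (ξ + 1) Φ ↔ ∀ n : ℕ, iter (Strat F ξ) (n + 1) fun r => Φ (scale n r) := by
  rw [Strat, Ordinal.limitRecOn_add_one]; rfl

theorem strat_limit (F : Filter X) {ξ : Ordinal.{v}} (hξ : Order.IsSuccLimit ξ)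
    (Φ : List (ℝ × X) → Prop) :
    Strat F ξ Φ ↔ ∀ ζ < ξ, Strat F (ζ + 1) Φ := by
  rw [Strat, Ordinal.limitRecOn_limit _ _ _ _ hξ]; rfl

@[simp] theorem el_nil : el ([] : List (ℝ × X)) = ∅ := by simp [el]

@[simp] theorem el_append (r r' : List (ℝ × X)) : el (r ++ r') = el r ∪ el r' := by
  ext x; simp [el, or_and_right, exists_or]

@[simp] theorem el_singleton (p : ℝ × X) : el [p] = {p.2} := by
  ext x; simp [el, eq_comm]

@[simp] theorem el_scale (n : ℕ) (r : List (ℝ × X)) : el (scale n r) = el r := by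
  ext x; simp [el, scale]

theorem el_finite (r : List (ℝ × X)) : (el r).Finite := by
  have : el r = Prod.snd '' {p | p ∈ r} := by ext; simp [el]
  rw [this]; exact (List.finite_toSet r).image _

@[simp] theorem wsum_nil (h : X → ℝ) : wsum [] h = 0 := by simp [wsum]

@[simp] theorem wsum_append (r r' : List (ℝ × X)) (h : X → ℝ) :
    wsum (r ++ r') h = wsum r h + wsum r' h := by simp [wsum]

@[simp] theorem wsum_singleton (p : ℝ × X) (h : X → ℝ) : wsum [p] h = p.1 * h p.2 := by
  simp [wsum]

theorem wsum_scale (n : ℕ) (r : List (ℝ × X)) (h : X → ℝ) :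
    wsum (scale n r) h = wsum r h / ((n : ℝ) + 1) := by
  induction r with
  | nil => simp [wsum, scale]
  | cons p r ih =>
    simp only [wsum, scale, List.map_cons, List.sum_cons, List.map_map] at ih ⊢
    rw [ih]; ring

/-- The weights are non-negative with sum `c`. -/
def Valid (c : ℝ) (r : List (ℝ × X)) : Prop := (∀ p ∈ r, 0 ≤ p.1) ∧ wsum r (fun _ => 1) = c

theorem Valid.append {c c' : ℝ} {r r' : List (ℝ × X)} (h : Valid c r) (h' : Valid c' r') :
    Valid (c + c') (r ++ r') := by
  refine ⟨fun p hp => ?_, by rw [wsum_append, h.2, h'.2]⟩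
  rcases List.mem_append.1 hp with hp | hp
  exacts [h.1 p hp, h'.1 p hp]

theorem Valid.scale {n : ℕ} {r : List (ℝ × X)} (h : Valid ((n : ℝ) + 1) r) :
    Valid 1 (scale n r) := by
  refine ⟨fun p hp => ?_, by rw [wsum_scale, h.2]; exact div_self (by positivity)⟩
  simp only [XiAUS.scale, List.mem_map] at hp
  obtain ⟨q, hq, rfl⟩ := hp
  have := h.1 q hq
  positivity

theorem Valid.el_nonempty {r : List (ℝ × X)} (h : Valid 1 r) : (el r).Nonempty := by
  cases r with
  | nil => simpa [wsum] using h.2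
  | cons p r => exact ⟨p.2, p, by simp, rfl⟩

theorem Valid.wsum_mono {c : ℝ} {r : List (ℝ × X)} (hr : Valid c r) {g h : X → ℝ} {d : ℝ}
    (hgh : ∀ x ∈ el r, g x ≤ h x + d) : wsum r g ≤ wsum r h + c * d := by
  obtain ⟨h0, hc⟩ := hr
  subst hc
  induction r with
  | nil => simp
  | cons p r ih =>
    have h1 := ih (fun x ⟨q, hq, e⟩ => hgh x ⟨q, by simp [hq], e⟩)
      (fun q hq => h0 q (by simp [hq]))
    have h2 := mul_le_mul_of_nonneg_left (hgh p.2 ⟨p, by simp, rfl⟩) (h0 p (by simp))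
    simp only [wsum, List.map_cons, List.sum_cons] at h1 ⊢
    nlinarith

/-- Quantifiers on runs that share the basic properties of `Strat F ξ`. -/
structure IsStrat (Q : (List (ℝ × X) → Prop) → Prop) : Prop where
  mono : ∀ {Φ Ψ : List (ℝ × X) → Prop}, (∀ r, Φ r → Ψ r) → Q Φ → Q Ψ
  exists_run : ∀ {Φ}, Q Φ → ∃ r, Φ r
  valid : ∀ {Φ}, Q Φ → Q fun r => Φ r ∧ Valid 1 r

namespace IsStrat

variable {Q : (List (ℝ × X) → Prop) → Prop}

theorem iter_mono (hQ : IsStrat Q) {n : ℕ} {Φ Ψ : List (ℝ × X) → Prop}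
    (h : ∀ r, Φ r → Ψ r) (hΦ : iter Q n Φ) : iter Q n Ψ := by
  induction n generalizing Φ Ψ with
  | zero => exact h _ hΦ
  | succ n ih => exact hQ.mono (fun r hr => ih (fun r' => h (r ++ r')) hr) hΦ

theorem iter_exists (hQ : IsStrat Q) {n : ℕ} {Φ : List (ℝ × X) → Prop}
    (hΦ : iter Q n Φ) : ∃ r, Φ r := by
  induction n generalizing Φ with
  | zero => exact ⟨_, hΦ⟩
  | succ n ih =>
    obtain ⟨r, hr⟩ := hQ.exists_run hΦ
    obtain ⟨r', hr'⟩ := ih hr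
    exact ⟨_, hr'⟩

theorem iter_valid (hQ : IsStrat Q) {n : ℕ} {Φ : List (ℝ × X) → Prop}
    (hΦ : iter Q n Φ) : iter Q n fun r => Φ r ∧ Valid n r := by
  induction n generalizing Φ with
  | zero => exact ⟨hΦ, by simp [Valid]⟩
  | succ n ih =>
    refine hQ.mono (fun r hr => hQ.iter_mono (fun r' hr' => ⟨hr'.1, ?_⟩) (ih hr.1)) (hQ.valid hΦ)
    have := hr.2.append hr'.2
    rwa [show (1 + n : ℝ) = ((n + 1 : ℕ) : ℝ) by push_cast; ring] at this

/-- Levels can be dropped if the condition is inherited by smaller sets of vectors. -/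
theorem iter_drop (hQ : IsStrat Q) {m n : ℕ} (hmn : m ≤ n) {P : Set X → Prop}
    (hP : ∀ S T, S ⊆ T → P T → P S) (h : iter Q n fun r => P (el r)) :
    iter Q m fun r => P (el r) := by
  induction n, hmn using Nat.le_induction generalizing P with
  | base => exact h
  | succ n hmn ih =>
    obtain ⟨r, hr⟩ := hQ.exists_run h
    exact ih hP (hQ.iter_mono (fun r' h' => hP _ _ (by simp) h') hr)

end IsStrat

theorem isStrat_strat (F : Filter X) (ξ : Ordinal.{v}) : IsStrat (Strat F ξ) := by
  induction ξ using Ordinal.limitRecOn with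
  | zero =>
    simp only [funext (fun Φ => propext (strat_zero F Φ))]
    refine ⟨fun h hΦ => hΦ.mono fun x => h _, fun h => ?_, fun h => ?_⟩
    · obtain ⟨x, hx⟩ := h.exists
      exact ⟨_, hx⟩
    · exact h.mono fun x hx => ⟨hx, by simp [Valid]⟩
  | add_one ξ ih =>
    simp only [funext (fun Φ => propext (strat_add_one F ξ Φ))]
    refine ⟨fun h hΦ n => ih.iter_mono (fun r => h _) (hΦ n), fun h => ?_, fun h n => ?_⟩
    · obtain ⟨r, hr⟩ := ih.iter_exists (h 0)
      exact ⟨_, hr⟩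
    · refine ih.iter_mono (fun r hr => ⟨hr.1, Valid.scale ?_⟩) (ih.iter_valid (h n))
      exact_mod_cast hr.2
  | limit ξ hξ ih =>
    simp only [funext (fun Φ => propext (strat_limit F hξ Φ))]
    refine ⟨fun h hΦ ζ hζ => (ih _ (hξ.add_one_lt hζ)).mono h (hΦ ζ hζ), fun h => ?_,
      fun h ζ hζ => (ih _ (hξ.add_one_lt hζ)).valid (h ζ hζ)⟩
    have h0 : 0 < ξ := hξ.bot_lt
    exact (ih _ (hξ.add_one_lt h0)).exists_run (h 0 h0)

/-- One level of order `ξ` is among the strategies of order `ξ + 1`, and a condition on the set of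
vectors does not see the rescaled weights. -/
theorem strat_drop (F : Filter X) {P : Set X → Prop}
    {ζ ξ : Ordinal.{v}} (hζ : ζ ≤ ξ) (h : Strat F ξ fun r => P (el r)) :
    Strat F ζ fun r => P (el r) := by
  induction ξ using Ordinal.limitRecOn with
  | zero => rwa [nonpos_iff_eq_zero.1 hζ]
  | add_one ξ ih =>
    rcases hζ.eq_or_lt with rfl | hlt
    · exact h
    · refine ih (Order.lt_add_one_iff.1 hlt) ?_
      have := (strat_add_one F ξ _).1 h 0
      simpa [iter] using this
  | limit ξ hξ ih =>
    rcases hζ.eq_or_lt with rfl | hlt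
    · exact h
    · exact ih _ (hξ.add_one_lt hlt) (le_of_lt (Order.lt_add_one_iff.2 le_rfl)) ((strat_limit F hξ _).1 h ζ hlt)

end Strategies

/-! ### From large weighted means to large values at every vector. -/

section Concentration

variable {X : Type u}

/-- On a finite set, the functions bounded by `M` are covered by finitely many `ε`-balls. -/
theorem exists_finite_rounding {S : Set X} (hS : S.Finite) (M : ℝ) {ε : ℝ} (hε : 0 < ε) :
    ∃ (κ : Type u) (_ : Finite κ) (v : κ → X → ℝ),
      ∀ h : X → ℝ, (∀ x ∈ S, |h x| ≤ M) → ∃ k, ∀ x ∈ S, |h x - v k x| ≤ ε := by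
  classical
  have := hS.to_subtype
  let q : ℤ := ⌈M / ε⌉
  -- Values are rounded down to multiples of `ε`. The index type lies in the universe of `X`, so
  -- that products of it with a colour set are again colour sets for `Concentrates`.
  refine ⟨S → Set.Icc (-q) q, inferInstance,
    fun k x => if hx : x ∈ S then ε * (k ⟨x, hx⟩ : ℤ) else 0, fun h hh => ?_⟩
  have hmem : ∀ x : S, ⌊h x / ε⌋ ∈ Set.Icc (-q) q := by
    intro x
    have h1 := abs_le.1 (hh x x.2)
    have h2 : h x / ε ≤ M / ε := div_le_div_of_nonneg_right h1.2 hε.le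
    have h3 : -(M / ε) ≤ h x / ε := by
      rw [← neg_div]; exact div_le_div_of_nonneg_right h1.1 hε.le
    have h4 := Int.le_ceil (M / ε)
    refine ⟨Int.le_floor.2 ?_, ?_⟩
    · push_cast; linarith
    · have := Int.floor_le (h x / ε)
      have h5 : ((⌊h x / ε⌋ : ℤ) : ℝ) ≤ (q : ℝ) := by linarith
      exact_mod_cast h5
  refine ⟨fun x => ⟨_, hmem x⟩, fun x hx => ?_⟩
  simp only [hx, dif_pos]
  have h1 := Int.floor_le (h x / ε)
  have h2 := Int.lt_floor_add_one (h x / ε)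
  rw [le_div_iff₀ hε] at h1
  rw [div_lt_iff₀ hε] at h2
  rw [abs_le]
  constructor <;> nlinarith

/-- If all runs admit a function, of one of finitely many colours, with large weighted sum, then
for one colour there is a strategy with runs that admit functions with large values at all
vectors. -/
def Concentrates (Q : (List (ℝ × X) → Prop) → Prop) : Prop :=
  ∀ (ι : Type u) [Finite ι] (Θ : ι → Set X → (X → ℝ) → Prop) (M : ℝ) (b : ι → ℝ) (δ : ℝ),
    (∀ i S T h, S ⊆ T → Θ i T h → Θ i S h) → 0 < δ →
    Q (fun r => ∃ i h, Θ i (el r) h ∧ (∀ x ∈ el r, |h x| ≤ M) ∧ b i ≤ wsum r h) →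
    ∃ i, Q (fun r => ∃ h, Θ i (el r) h ∧ ∀ x ∈ el r, b i - δ ≤ h x)

/-- Of the `n` levels, `m` are kept, on which the function is at least about `c i` everywhere. Each
dropped level contributes at most about `c i` to the total and each kept one at most `M`, which
gives the counting inequality and hence many kept levels when `B i` is well above `n * c i`. -/
theorem IsStrat.concentrate_iter {Q : (List (ℝ × X) → Prop) → Prop} (hQ : IsStrat Q)
    (hC : Concentrates Q) (n : ℕ) (ι : Type u) [Finite ι] (Θ : ι → Set X → (X → ℝ) → Prop)
    (M : ℝ) (B c : ι → ℝ) (δ : ℝ) (hΘ : ∀ i S T h, S ⊆ T → Θ i T h → Θ i S h) (hδ : 0 < δ)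
    (H : iter Q n fun r => ∃ i h, Θ i (el r) h ∧ (∀ x ∈ el r, |h x| ≤ M) ∧ B i ≤ wsum r h) :
    ∃ i, ∃ m ≤ n, B i - n * δ ≤ ((n : ℝ) - m) * c i + m * M ∧
      iter Q m fun r => ∃ h, Θ i (el r) h ∧ ∀ x ∈ el r, c i - δ ≤ h x := by
  induction n generalizing ι with
  | zero =>
    obtain ⟨i, h, h1, -, h3⟩ := H
    exact ⟨i, 0, le_rfl, by simpa using h3, h, h1, by simp⟩
  | succ n ih =>
    -- For a fixed first run, the possible behaviours of the functions on it are rounded to finitely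
    -- many `g`; these serve as extra colours for the remaining levels. Afterwards the rest of the
    -- game is absorbed into the condition on `g`, and the new colour records how many later levels
    -- are kept.
    have key : Q fun r => ∃ (i : ι × Fin (n + 1)) (g : X → ℝ),
        (iter Q i.2 fun r' => ∃ h, Θ i.1 (el r ∪ el r') h ∧
          (∀ x ∈ el r, |h x| ≤ M ∧ |h x - g x| ≤ δ / 4) ∧ ∀ x ∈ el r', c i.1 - δ ≤ h x) ∧
        (∀ x ∈ el r, |g x| ≤ M + δ / 4) ∧
        B i.1 - δ / 4 - n * δ - (((n : ℝ) - i.2) * c i.1 + i.2 * M) ≤ wsum r g := by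
      refine hQ.mono (fun r hr => ?_) (hQ.valid H)
      obtain ⟨hr, hval⟩ := hr
      obtain ⟨κ, _, g, hg⟩ := exists_finite_rounding (el_finite r) M
        (ε := δ / 4) (by positivity)
      obtain ⟨⟨i, k⟩, m, hmn, hcount, hm⟩ := ih (ι × κ)
        (fun j S h => Θ j.1 (el r ∪ S) h ∧ ∀ x ∈ el r, |h x| ≤ M ∧ |h x - g j.2 x| ≤ δ / 4)
        (fun j => B j.1 - δ / 4 - wsum r (g j.2)) (fun j => c j.1)
        (fun j S T h hST hT => ⟨hΘ _ _ _ _ (Set.union_subset_union_right _ hST) hT.1, hT.2⟩)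
        (hQ.iter_mono (fun r' h' => by
          obtain ⟨i, h, h1, h2, h3⟩ := h'
          rw [el_append] at h1 h2
          obtain ⟨k, hk⟩ := hg h fun x hx => h2 x (Or.inl hx)
          refine ⟨(i, k), h, ⟨h1, fun x hx => ⟨h2 x (Or.inl hx), hk x hx⟩⟩,
            fun x hx => h2 x (Or.inr hx), ?_⟩
          have := hval.wsum_mono (g := h) (h := g k) (d := δ / 4) fun x hx => by
            linarith [(abs_le.1 (hk x hx)).2]
          rw [wsum_append] at h3
          dsimp only
          linarith) hr)
      refine ⟨(i, ⟨m, by omega⟩), g k, hQ.iter_mono (fun r' h' => ?_) hm, fun x hx => ?_, ?_⟩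
      · obtain ⟨h, ⟨h1, h2⟩, h3⟩ := h'
        exact ⟨h, h1, h2, h3⟩
      · obtain ⟨r', h, ⟨-, h2⟩, -⟩ := hQ.iter_exists hm
        obtain ⟨h3, h4⟩ := h2 x hx
        rw [abs_le] at h3 h4 ⊢
        constructor <;> linarith
      · dsimp only at hcount ⊢
        linarith
    obtain ⟨⟨i, ⟨m, hm⟩⟩, hi⟩ := hC (ι × Fin (n + 1))
      (fun i S g => iter Q i.2 fun r' => ∃ h, Θ i.1 (S ∪ el r') h ∧
          (∀ x ∈ S, |h x| ≤ M ∧ |h x - g x| ≤ δ / 4) ∧ ∀ x ∈ el r', c i.1 - δ ≤ h x)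
      (M + δ / 4) _ (δ / 4)
      (fun i S T g hST => hQ.iter_mono fun r' ⟨h, h1, h2, h3⟩ =>
        ⟨h, hΘ _ _ _ _ (Set.union_subset_union_left _ hST) h1, fun x hx => h2 x (hST hx), h3⟩)
      (by positivity) key
    dsimp only at hi
    -- The right-hand side is the lower bound obtained on the first level: if it reaches `c i` the
    -- level is kept, otherwise it counts as a dropped one.
    rcases le_or_gt (c i) (B i - δ / 4 - n * δ - (((n : ℝ) - m) * c i + m * M)) with hle | hlt
    · refine ⟨i, m + 1, by omega, ?_, hQ.mono (fun r hr => ?_) hi⟩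
      · obtain ⟨r, ⟨g, hr, hg⟩, hval⟩ := hQ.exists_run (hQ.valid hi)
        obtain ⟨x, hx⟩ := hval.el_nonempty
        obtain ⟨r', h, -, h2, -⟩ := hQ.iter_exists hr
        have h3 := hg x hx
        obtain ⟨h4, h5⟩ := h2 x hx
        rw [abs_le] at h4 h5
        push_cast
        linarith
      · obtain ⟨g, hr, hg⟩ := hr
        refine hQ.iter_mono (fun r' h' => ?_) hr
        obtain ⟨h, h1, h2, h3⟩ := h'
        rw [el_append]
        refine ⟨h, h1, fun x hx => ?_⟩
        rcases hx with hx | hx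
        · have h4 := hg x hx
          have h5 := (abs_le.1 (h2 x hx).2).1
          linarith
        · exact h3 x hx
    · refine ⟨i, m, by omega, ?_, ?_⟩
      · push_cast
        linarith
      · obtain ⟨r, g, hr, -⟩ := hQ.exists_run hi
        exact hQ.iter_mono (fun r' ⟨h, h1, _, h3⟩ =>
          ⟨h, hΘ _ _ _ _ Set.subset_union_right h1, h3⟩) hr

/-- At successors, every colour is assumed to fail for some number of levels; a long enough game
keeps more levels than that for one colour, and superfluous levels can be dropped. At limits, a
finite set of failing ordinals has a maximum below `ξ`. -/
theorem concentrates_strat (F : Filter X) (ξ : Ordinal.{v}) : Concentrates (Strat F ξ) := by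
  induction ξ using Ordinal.limitRecOn with
  | zero =>
    intro ι _ Θ M b δ hΘ hδ H
    simp only [strat_zero, el_singleton, wsum_singleton, one_mul, Set.mem_singleton_iff,
      forall_eq] at H ⊢
    by_contra! hcon
    refine H ((Filter.eventually_all.2 hcon).mono fun x hx => ?_)
    rintro ⟨i, h, h1, -, h3⟩
    linarith [hx i h h1]
  | add_one ξ ih =>
    intro ι _ Θ M b δ hΘ hδ H
    have hQ := isStrat_strat F ξ
    simp only [strat_add_one, el_scale, wsum_scale] at H ⊢
    by_contra! hcon
    choose m hm using hcon
    obtain ⟨m0, hm0⟩ := (Set.finite_range m).bddAbove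
    obtain ⟨C, hC⟩ := (Set.finite_range fun i => M - b i + δ / 2).bddAbove
    obtain ⟨n, hn⟩ := exists_nat_gt (((m0 : ℝ) + 1) * |C| / (δ / 4))
    rw [div_lt_iff₀ (by positivity)] at hn
    -- With threshold `b i - δ / 2` and loss `δ / 4` per level, the counting inequality reads `(n +
    -- 1) * δ / 4 ≤ k * (M - b i + δ / 2)`, so `k` grows with `n`.
    obtain ⟨i, k, hkn, hk1, hk2⟩ := hQ.concentrate_iter ih (n + 1) ι Θ M
      (fun i => ((n : ℝ) + 1) * b i) (fun i => b i - δ / 2) (δ / 4) hΘ (by positivity)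
      (hQ.iter_mono (fun r ⟨i, h, h1, h2, h3⟩ => ⟨i, h, h1, h2, by
        rwa [le_div_iff₀' (by positivity)] at h3⟩) (H n))
    have hCi : M - b i + δ / 2 ≤ |C| := (hC ⟨i, rfl⟩).trans (le_abs_self _)
    have hmi : m i ≤ m0 := hm0 ⟨i, rfl⟩
    have hlt : m i + 1 ≤ k := by
      by_contra! hlt
      have h1 : (k : ℝ) ≤ m0 + 1 := by
        have : k ≤ m0 + 1 := by omega
        exact_mod_cast this
      have h2 : (k : ℝ) * (M - b i + δ / 2) ≤ (m0 + 1) * |C| :=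
        (mul_le_mul_of_nonneg_left hCi (by positivity)).trans
          (mul_le_mul_of_nonneg_right h1 (abs_nonneg _))
      push_cast at hk1
      nlinarith
    refine hm i (hQ.iter_drop hlt
      (P := fun S => ∃ h, Θ i S h ∧ ∀ x ∈ S, b i - δ ≤ h x)
      (fun S T hST ⟨h, h1, h2⟩ => ⟨h, hΘ _ _ _ _ hST h1, fun x hx => h2 x (hST hx)⟩) ?_)
    exact hQ.iter_mono (fun r ⟨h, h1, h2⟩ => ⟨h, h1, fun x hx => by linarith [h2 x hx]⟩) hk2
  | limit ξ hξ ih =>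
    intro ι _ Θ M b δ hΘ hδ H
    rw [strat_limit F hξ] at H
    simp only [strat_limit F hξ]
    by_contra! hcon
    choose ζ hζ hζ' using hcon
    obtain ⟨ζ₀, hζ₀, hle⟩ : ∃ ζ₀ < ξ, ∀ i, ζ i ≤ ζ₀ := by
      rcases isEmpty_or_nonempty ι with hι | hι
      · exact ⟨0, hξ.bot_lt, fun i => (hι.false i).elim⟩
      · obtain ⟨j, hj⟩ := Finite.exists_max ζ
        exact ⟨ζ j, hζ j, hj⟩
    obtain ⟨i, hi⟩ := ih _ (hξ.add_one_lt hζ₀) ι Θ M b δ hΘ hδ (H ζ₀ hζ₀)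
    exact hζ' i (strat_drop F (P := fun S => ∃ h, Θ i S h ∧ ∀ x ∈ S, b i - δ ≤ h x)
      (by gcongr; exact hle i) hi)

end Concentration

/-! ### Convex blocks of runs, and convex functions along strategies. -/

section Vectors

variable {X : Type u}

theorem iter_eventually {Q : (List (ℝ × X) → Prop) → Prop} (hQ : IsStrat Q) {S : Set X}
    (h : ∀ {Φ}, Q Φ → Q fun r => Φ r ∧ el r ⊆ S) {n : ℕ} {Φ : List (ℝ × X) → Prop}
    (hΦ : iter Q n Φ) : iter Q n fun r => Φ r ∧ el r ⊆ S := by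
  induction n generalizing Φ with
  | zero => exact ⟨hΦ, by simp⟩
  | succ n ih =>
    refine hQ.mono (fun r hr => hQ.iter_mono (fun r' hr' => ⟨hr'.1, ?_⟩) (ih hr.1)) (h hΦ)
    rw [el_append]
    exact Set.union_subset hr.2 hr'.2

theorem strat_eventually {F : Filter X} {S : Set X} (hS : ∀ᶠ x in F, x ∈ S) {ξ : Ordinal.{v}}
    {Φ : List (ℝ × X) → Prop} (hΦ : Strat F ξ Φ) : Strat F ξ fun r => Φ r ∧ el r ⊆ S := by
  induction ξ using Ordinal.limitRecOn generalizing Φ with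
  | zero =>
    rw [strat_zero] at hΦ ⊢
    exact (hΦ.and_eventually hS).mono fun x hx => ⟨hx.1, by simpa using hx.2⟩
  | add_one ξ ih =>
    rw [strat_add_one] at hΦ ⊢
    intro n
    simpa using iter_eventually (isStrat_strat F ξ) ih (hΦ n)
  | limit ξ hξ ih =>
    rw [strat_limit F hξ] at hΦ ⊢
    exact fun ζ hζ => ih _ (hξ.add_one_lt hζ) (hΦ ζ hζ)

theorem iter_frequently {Q : (List (ℝ × X) → Prop) → Prop} (hQ : IsStrat Q) {S : Set X}
    (h : Q fun r => el r ⊆ S) (n : ℕ) : iter Q n fun r => el r ⊆ S := by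
  induction n with
  | zero => simp [iter]
  | succ n ih =>
    refine hQ.mono (fun r hr => hQ.iter_mono (fun r' hr' => ?_) ih) h
    simp only [el_append]
    exact Set.union_subset hr hr'

/-- Used with `S = {0}`: the zero collection is always available to the player. -/
theorem strat_frequently {F : Filter X} {S : Set X} (hS : ∃ᶠ x in F, x ∈ S) (ξ : Ordinal.{v}) :
    Strat F ξ fun r => el r ⊆ S := by
  induction ξ using Ordinal.limitRecOn with
  | zero =>
    rw [strat_zero]
    simpa using hS
  | add_one ξ ih =>
    rw [strat_add_one]
    intro n
    simpa using iter_frequently (isStrat_strat F ξ) ih (n + 1)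
  | limit ξ hξ ih =>
    rw [strat_limit F hξ]
    exact fun ζ hζ => ih _ (hξ.add_one_lt hζ)

theorem iter_map {Q : (List (ℝ × X) → Prop) → Prop} (hQ : IsStrat Q) {g : X → X}
    (h : ∀ {Φ}, (Q fun r => Φ (r.map (Prod.map id g))) → Q Φ) {n : ℕ}
    {Φ : List (ℝ × X) → Prop} (hΦ : iter Q n fun r => Φ (r.map (Prod.map id g))) :
    iter Q n Φ := by
  induction n generalizing Φ with
  | zero => exact hΦ
  | succ n ih =>
    refine h (hQ.mono (fun r hr => ih ?_) hΦ)
    simpa only [List.map_append] using hr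

/-- Applying `g` to every move of a strategy gives a strategy again; used for unimodular scalars, to
make the new norm balanced over `𝕜`. -/
theorem strat_map {F : Filter X} {g : X → X} (hg : Filter.Tendsto g F F) {ξ : Ordinal.{v}}
    {Φ : List (ℝ × X) → Prop} (hΦ : Strat F ξ fun r => Φ (r.map (Prod.map id g))) :
    Strat F ξ Φ := by
  induction ξ using Ordinal.limitRecOn generalizing Φ with
  | zero =>
    rw [strat_zero] at hΦ ⊢
    exact hg.frequently hΦ
  | add_one ξ ih =>
    rw [strat_add_one] at hΦ ⊢
    intro n
    refine iter_map (isStrat_strat F ξ) ih ((isStrat_strat F ξ).iter_mono (fun r hr => ?_) (hΦ n))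
    simpa [scale, Function.comp_def] using hr
  | limit ξ hξ ih =>
    rw [strat_limit F hξ] at hΦ ⊢
    exact fun ζ hζ => ih _ (hξ.add_one_lt hζ) (hΦ ζ hζ)

/-- The weighted sum of the vectors of a run. -/
def vsum [AddCommGroup X] [Module ℝ X] (r : List (ℝ × X)) : X := (r.map fun p => p.1 • p.2).sum

@[simp] theorem vsum_nil [AddCommGroup X] [Module ℝ X] : vsum ([] : List (ℝ × X)) = 0 := by
  simp [vsum]

@[simp] theorem vsum_append [AddCommGroup X] [Module ℝ X] (r r' : List (ℝ × X)) :
    vsum (r ++ r') = vsum r + vsum r' := by simp [vsum]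

theorem wsum_affine [AddCommGroup X] [Module ℝ X] (r : List (ℝ × X)) (L : X →ₗ[ℝ] ℝ) (c : ℝ) :
    wsum r (fun x => L x + c) = L (vsum r) + wsum r (fun _ => 1) * c := by
  induction r with
  | nil => simp
  | cons p r ih =>
    simp only [wsum, vsum, List.map_cons, List.sum_cons, map_add, map_smul, smul_eq_mul] at ih ⊢
    rw [ih]; ring

theorem norm_vsum_le [NormedAddCommGroup X] [NormedSpace ℝ X] {r : List (ℝ × X)} {c σ : ℝ}
    (hr : Valid c r) (h : ∀ x ∈ el r, ‖x‖ ≤ σ) : ‖vsum r‖ ≤ c * σ := by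
  have h1 : ‖vsum r‖ ≤ wsum r fun x => ‖x‖ := by
    obtain ⟨h0, -⟩ := hr
    clear h
    induction r with
    | nil => simp
    | cons p r ih =>
      have := ih fun q hq => h0 q (by simp [hq])
      have hp := h0 p (by simp)
      simp only [wsum, vsum, List.map_cons, List.sum_cons] at this ⊢
      refine (norm_add_le _ _).trans ?_
      rw [norm_smul, Real.norm_of_nonneg hp]
      gcongr
  have h2 := hr.wsum_mono (g := fun x => ‖x‖) (h := fun _ => 0) (d := σ) (by simpa using h)
  have h3 : wsum r (fun _ => (0 : ℝ)) = 0 := by simp [wsum]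
  linarith

theorem vsum_mem_convexHull [AddCommGroup X] [Module ℝ X] {r : List (ℝ × X)}
    (hr : Valid 1 r) : vsum r ∈ convexHull ℝ (el r) := by
  -- Tails of a run have arbitrary total weight, possibly zero, so the induction is carried out for
  -- unnormalised sums.
  have key : ∀ (s : List (ℝ × X)) (C : Set X), Convex ℝ C → el s ⊆ C → C.Nonempty →
      (∀ p ∈ s, 0 ≤ p.1) → ∃ y ∈ C, vsum s = wsum s (fun _ => 1) • y := by
    intro s C hC hs hne h0
    induction s with
    | nil => exact ⟨_, hne.some_mem, by simp⟩
    | cons p s ih =>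
      obtain ⟨y, hy, hy'⟩ := ih (fun x ⟨q, hq, e⟩ => hs ⟨q, by simp [hq], e⟩)
        (fun q hq => h0 q (by simp [hq]))
      have hp := h0 p (by simp)
      have ht : 0 ≤ wsum s (fun _ => 1) := by
        simp only [wsum, mul_one]
        refine List.sum_nonneg fun a ha => ?_
        obtain ⟨q, hq, rfl⟩ := List.mem_map.1 ha
        exact h0 q (by simp [hq])
      have e1 : vsum (p :: s) = p.1 • p.2 + vsum s := by simp [vsum]
      have e2 : wsum (p :: s) (fun _ => 1) = p.1 + wsum s (fun _ => 1) := by simp [wsum]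
      rw [e1, e2, hy']
      rcases (add_nonneg hp ht).eq_or_lt with h | h
      · have h1 : p.1 = 0 := by linarith
        have h2 : wsum s (fun _ => 1) = 0 := by linarith
        exact ⟨y, hy, by simp [h1, h2]⟩
      · refine ⟨_, convex_iff_div.1 hC (hs ⟨p, by simp, rfl⟩) hy hp ht h, ?_⟩
        rw [smul_add, smul_smul, smul_smul, mul_div_cancel₀ _ h.ne', mul_div_cancel₀ _ h.ne']
  obtain ⟨y, hy, e⟩ := key r _ (convex_convexHull ℝ _) (subset_convexHull ℝ _)
    (hr.el_nonempty.convexHull) hr.1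
  rw [e, hr.2, one_smul]
  exact hy

/-- A convex function that is large at the block has an affine minorant that is large there, and the
value of an affine function at the block is its weighted mean. Concentration makes such minorants of
a single `g i` large at all vectors, hence at their convex combination. -/
theorem strat_exists_convex [NormedAddCommGroup X] [NormedSpace ℝ X] {F : Filter X} {σ : ℝ}
    (hF : ∀ᶠ x in F, ‖x‖ ≤ σ) (ξ : Ordinal.{v}) {ι : Type u} [Finite ι] (g : ι → X → ℝ)
    (hg : ∀ i, ConvexOn ℝ Set.univ (g i)) (hlip : ∀ i x y, g i x ≤ g i y + ‖x - y‖)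
    (l : ι → ℝ) {δ : ℝ} (hδ : 0 < δ) (H : Strat F ξ fun r => ∃ i, l i ≤ g i (vsum r)) :
    ∃ i, Strat F ξ fun r => l i - δ ≤ g i (vsum r) := by
  have hQ := isStrat_strat F ξ
  -- On the ball of radius `3 * σ` a minorant is at most `|g i 0| + 3 * σ`. Reflecting `x` in the
  -- block `z` to `2z - x`, which stays in this ball, turns that into a lower bound, as the value at
  -- `z` is `l i - δ / 2`.
  obtain ⟨M, hM⟩ := (Set.finite_range fun i => |g i 0| + 3 * σ + 2 * |l i - δ / 2|).bddAbove
  obtain ⟨i, hi⟩ := concentrates_strat F ξ ι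
    (fun i _ h => ∃ (L : X →ₗ[ℝ] ℝ) (c : ℝ), h = (fun x => L x + c) ∧ ∀ x, L x + c ≤ g i x)
    M (fun i => l i - δ / 2) (δ / 2) (fun _ _ _ _ _ h => h) (by positivity) (by
      refine hQ.mono (fun r ⟨⟨⟨i, hi⟩, hval⟩, hr⟩ => ?_)
        (strat_eventually (S := {x | ‖x‖ ≤ σ}) hF (hQ.valid H))
      have hcont : Continuous (g i) := by
        refine LipschitzWith.continuous (K := 1) (LipschitzWith.of_le_add fun x y => ?_)
        rw [dist_eq_norm]; exact hlip i x y
      obtain ⟨L, c, hle, heq⟩ := ConvexOn.exists_affine_le_of_lt (𝕜 := ℝ) (Set.mem_univ (vsum r))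
        (show l i - δ / 2 < g i (vsum r) by linarith) isClosed_univ
        (hcont.lowerSemicontinuous.lowerSemicontinuousOn _) (hg i)
      have hle' : ∀ x, L x + c ≤ g i x := fun x => by simpa using hle ⟨x, Set.mem_univ _⟩
      have heq' : L (vsum r) + c = l i - δ / 2 := by simpa using heq
      have hbd : ∀ x, ‖x‖ ≤ 3 * σ → L x + c ≤ |g i 0| + 3 * σ := fun x hx => by
        have h1 := hlip i x 0
        rw [sub_zero] at h1
        linarith [hle' x, le_abs_self (g i 0)]
      have hz := norm_vsum_le hval hr
      rw [one_mul] at hz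
      have hσ : 0 ≤ σ := (norm_nonneg _).trans hz
      have hMi := hM ⟨i, rfl⟩
      dsimp only at hMi
      refine ⟨i, fun x => L x + c, ⟨L, c, rfl, hle'⟩, fun x hx => abs_le.2 ⟨?_, ?_⟩, ?_⟩
      · have hx : ‖x‖ ≤ σ := hr hx
        have h1 := hbd ((2 : ℝ) • vsum r - x) (by
          refine (norm_sub_le _ _).trans ?_
          rw [norm_smul]
          norm_num
          linarith)
        rw [map_sub, map_smul, smul_eq_mul] at h1
        linarith [neg_abs_le (l i - δ / 2)]
      · have hx : ‖x‖ ≤ σ := hr hx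
        linarith [hbd x (by linarith), abs_nonneg (l i - δ / 2)]
      · have := wsum_affine r (L : X →ₗ[ℝ] ℝ) c
        rw [hval.2] at this
        simp only [ContinuousLinearMap.coe_coe] at this
        rw [this]
        linarith)
  refine ⟨i, hQ.mono (fun r hr => ?_) (hQ.valid hi)⟩
  obtain ⟨⟨h, ⟨L, c, rfl, hle⟩, hr⟩, hval⟩ := hr
  have h1 := hval.wsum_mono (g := fun _ => l i - δ) (h := fun x => L x + c) (d := 0)
    fun x hx => by linarith [hr x hx]
  have h2 := wsum_affine r (0 : X →ₗ[ℝ] ℝ) (l i - δ)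
  rw [wsum_affine, hval.2] at h1
  simp only [LinearMap.zero_apply, zero_add, hval.2] at h2
  linarith [hle (vsum r)]

end Vectors

/-! ### Strategies from weakly null collections on arbitrary `B`-trees. -/

section Derivatives

variable {Λ : Type w}

theorem deriv_zero (T : Set (List Λ)) : deriv T (0 : Ordinal.{v}) = T := by
  rw [deriv, Ordinal.limitRecOn_zero]

theorem deriv_add_one (T : Set (List Λ)) (α : Ordinal.{v}) :
    deriv T (α + 1) = deriv T α \ maxElems (deriv T α) := by
  rw [deriv, Ordinal.limitRecOn_add_one]; rfl

theorem deriv_limit (T : Set (List Λ)) {α : Ordinal.{v}} (hα : Order.IsSuccLimit α) :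
    deriv T α = ⋂ (γ : Ordinal.{v}) (_ : γ < α), deriv T γ := by
  rw [deriv, Ordinal.limitRecOn_limit _ _ _ _ hα]; rfl

theorem deriv_anti (T : Set (List Λ)) {α β : Ordinal.{v}} (h : α ≤ β) :
    deriv T β ⊆ deriv T α := by
  induction β using Ordinal.limitRecOn with
  | zero => rw [nonpos_iff_eq_zero.1 h]
  | add_one β ih =>
    rcases h.eq_or_lt with rfl | hlt
    · exact subset_rfl
    · rw [deriv_add_one]
      exact Set.sdiff_subset.trans (ih (Order.lt_add_one_iff.1 hlt))
  | limit β hβ ih =>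
    rcases h.eq_or_lt with rfl | hlt
    · exact subset_rfl
    · rw [deriv_limit T hβ]
      exact Set.iInter₂_subset α hlt

theorem deriv_mono {S T : Set (List Λ)} (h : S ⊆ T) (α : Ordinal.{v}) :
    deriv S α ⊆ deriv T α := by
  induction α using Ordinal.limitRecOn with
  | zero => rwa [deriv_zero, deriv_zero]
  | add_one α ih =>
    rw [deriv_add_one, deriv_add_one]
    rintro t ⟨ht, hmax⟩
    exact ⟨ih ht, fun hm => hmax ⟨ht, fun s hs hts => hm.2 s (ih hs) hts⟩⟩
  | limit α hα ih =>
    rw [deriv_limit S hα, deriv_limit T hα]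
    exact Set.iInter₂_mono ih

theorem deriv_subset (T : Set (List Λ)) (α : Ordinal.{v}) : deriv T α ⊆ T := by
  simpa [deriv_zero] using deriv_anti T (zero_le (a := α))

/-- The root is removed only after everything above it is gone, so it survives up to the order of
`B`. -/
theorem nil_mem_deriv {B : Set (List Λ)} (hB : IsBTree B) {α : Ordinal.{v}}
    (h : ∀ β < α, (deriv B β).Nonempty) : [] ∈ deriv (insert [] B) α := by
  induction α using Ordinal.limitRecOn with
  | zero => simp [deriv_zero]
  | add_one α ih =>
    rw [deriv_add_one]
    refine ⟨ih fun β hβ => h β (hβ.trans (Order.lt_add_one_iff.2 le_rfl)), fun hm => ?_⟩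
    obtain ⟨t, ht⟩ := h α (Order.lt_add_one_iff.2 le_rfl)
    have h1 := hm.2 t (deriv_mono (Set.subset_insert _ _) α ht) List.nil_prefix
    subst h1
    exact hB.1 (deriv_subset B α ht)
  | limit α hα ih =>
    rw [deriv_limit _ hα]
    exact Set.mem_iInter₂.2 fun β hβ => ih β hβ fun γ hγ => h γ (hγ.trans hβ)

variable {X : Type u}

theorem iter_of_deriv {Q : (List (ℝ × X) → Prop) → Prop} (hQ : IsStrat Q) {B : Set (List Λ)}
    {x : List Λ → X} {β : Ordinal.{v}}
    (h : ∀ (α : Ordinal.{v}) (t : List Λ), t ∈ deriv (insert [] B) (α + β) →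
      Q fun r => ∃ t' ∈ deriv (insert [] B) α, t <+: t' ∧ el r ⊆ x '' {s | s ∈ B ∧ s <+: t'})
    (n : ℕ) {α : Ordinal.{v}} {t : List Λ} (ht : t ∈ deriv (insert [] B) (α + β * n)) :
    iter Q n fun r =>
      ∃ t' ∈ deriv (insert [] B) α, t <+: t' ∧ el r ⊆ x '' {s | s ∈ B ∧ s <+: t'} := by
  induction n generalizing t with
  | zero => exact ⟨t, by simpa using ht, List.prefix_rfl, by simp⟩
  | succ n ih =>
    rw [Nat.cast_succ, mul_add_one, ← add_assoc] at ht
    refine hQ.mono (fun r ⟨t', ht', htt', hr⟩ => hQ.iter_mono (fun r' hr' => ?_) (ih ht'))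
      (h _ t ht)
    obtain ⟨t'', ht'', htt'', hr'⟩ := hr'
    refine ⟨t'', ht'', htt'.trans htt'', ?_⟩
    rw [el_append]
    exact Set.union_subset (hr.trans (Set.image_mono fun s hs => ⟨hs.1, hs.2.trans htt''⟩)) hr'

/-- A node of rank `α + ω ^ ξ` leaves room for a game of order `ξ` that ends at a node of rank `α`.
Keeping `α` arbitrary lets such games be chained: `n` of them use `ω ^ ξ * n ≤ ω ^ (ξ + 1)`. -/
theorem strat_of_deriv {F : Filter X} {B : Set (List Λ)} {x : List Λ → X}
    (hx : ∀ (α : Ordinal.{v}) (t : List Λ), t ∈ deriv (insert [] B) (α + 1) →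
      ∃ᶠ y in F, y ∈ x '' {s | s ∈ deriv B α ∧ ∃ a : Λ, s = t ++ [a]})
    (ξ α : Ordinal.{v}) {t : List Λ} (ht : t ∈ deriv (insert [] B) (α + Ordinal.omega0 ^ ξ)) :
    Strat F ξ fun r =>
      ∃ t' ∈ deriv (insert [] B) α, t <+: t' ∧ el r ⊆ x '' {s | s ∈ B ∧ s <+: t'} := by
  induction ξ using Ordinal.limitRecOn generalizing α t with
  | zero =>
    rw [Ordinal.opow_zero] at ht
    rw [strat_zero]
    refine (hx α t ht).mono ?_
    rintro _ ⟨s, ⟨hs, a, rfl⟩, rfl⟩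
    refine ⟨t ++ [a], deriv_mono (Set.subset_insert _ _) α hs, List.prefix_append _ _, ?_⟩
    simp only [el_singleton, Set.singleton_subset_iff]
    exact ⟨_, ⟨deriv_subset B α hs, List.prefix_rfl⟩, rfl⟩
  | add_one ξ ih =>
    rw [strat_add_one]
    intro n
    simp only [el_scale]
    refine iter_of_deriv (isStrat_strat F ξ) ih (n + 1) (deriv_anti _ ?_ ht)
    gcongr
    rw [Ordinal.opow_add_one]
    gcongr
    exact (Ordinal.natCast_lt_omega0 _).le
  | limit ξ hξ ih =>
    rw [strat_limit F hξ]
    intro ζ hζ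
    refine ih _ (hξ.add_one_lt hζ) α (deriv_anti _ ?_ ht)
    gcongr
    · exact Ordinal.omega0_pos
    · exact (hξ.add_one_lt hζ).le

/-- A collection on a `B`-tree of order `ω ^ ξ` that is null with respect to `F` yields a strategy
whose runs stay in the branches of the tree. -/
theorem strat_of_tree {F : Filter X} {B : Set (List Λ)} (hB : IsBTree B) {x : List Λ → X}
    {ξ : Ordinal.{v}} (ho : HasOrder B (Ordinal.omega0 ^ ξ))
    (hx : ∀ (α : Ordinal.{v}) (t : List Λ), t ∈ deriv (insert [] B) (α + 1) →
      ∃ᶠ y in F, y ∈ x '' {s | s ∈ deriv B α ∧ ∃ a : Λ, s = t ++ [a]}) :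
    Strat F ξ fun r => ∃ t ∈ B, el r ⊆ x '' {s | s ∈ B ∧ s <+: t} := by
  have hQ := isStrat_strat F ξ
  have h0 : [] ∈ deriv (insert [] B) (0 + Ordinal.omega0 ^ ξ) := by
    rw [zero_add]
    refine nil_mem_deriv hB fun β hβ => Set.nonempty_iff_ne_empty.2 fun h => ?_
    exact absurd (ho.2 h) (not_le.2 hβ)
  refine hQ.mono (fun r ⟨⟨t, ht, _, hr⟩, hval⟩ => ⟨t, ?_, hr⟩)
    (hQ.valid (strat_of_deriv hx ξ 0 h0))
  -- The final node is not the added root, because a run of total weight `1` contains a vector.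
  obtain ⟨y, hy⟩ := hval.el_nonempty
  obtain ⟨s, ⟨hs, hst⟩, -⟩ := hr hy
  rw [deriv_zero] at ht
  refine ht.resolve_left ?_
  rintro rfl
  rw [List.prefix_nil.1 hst] at hs
  exact hB.1 hs

end Derivatives

/-! ### Collections on grafted trees, disjoint unions and relabelled trees. -/

section Collections

variable {Λ : Type w} {X : Type u}

theorem prefix_of_maxElems {T : Set (List Λ)} {t t' s s' : List Λ} (ht : t ∈ maxElems T)
    (ht' : t' ∈ maxElems T) (h : t ++ s <+: t' ++ s') : t = t' ∧ s <+: s' := by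
  have h1 : t <+: t' ++ s' := (List.prefix_append t s).trans h
  have h2 : t = t' := by
    rcases List.prefix_or_prefix_of_prefix h1 (List.prefix_append t' s') with h3 | h3
    · exact (ht.2 _ ht'.1 h3).symm
    · exact ht'.2 _ ht.1 h3
  subst h2
  exact ⟨rfl, (List.prefix_append_right_inj t).1 h⟩

/-- The tree `R` grafted on the maximal members of `T`. -/
def graft (T R : Set (List Λ)) : Set (List Λ) :=
  T ∪ {r | ∃ t ∈ maxElems T, ∃ s ∈ R, r = t ++ s}

theorem append_notMem_of_maxElems {T : Set (List Λ)} {t s : List Λ} (ht : t ∈ maxElems T)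
    (hs : s ≠ []) : t ++ s ∉ T := fun h => hs (by simpa using ht.2 _ h (List.prefix_append t s))

theorem mem_maxElems_graft {T R : Set (List Λ)} (hR : IsBTree R) (hne : R.Nonempty)
    {u : List Λ} :
    u ∈ maxElems (graft T R) ↔ ∃ t ∈ maxElems T, ∃ s ∈ maxElems R, u = t ++ s := by
  constructor
  · rintro ⟨hu, hmax⟩
    rcases hu with hu | ⟨t, ht, s, hs, rfl⟩
    · exfalso
      have hu' : u ∈ maxElems T := ⟨hu, fun s hs => hmax s (Or.inl hs)⟩
      obtain ⟨s, hs⟩ := hne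
      have h1 := hmax (u ++ s) (Or.inr ⟨u, hu', s, hs, rfl⟩) (List.prefix_append u s)
      obtain rfl : s = [] := by simpa using h1
      exact hR.1 hs
    · refine ⟨t, ht, s, ⟨hs, fun s' hs' hss' => ?_⟩, rfl⟩
      simpa using hmax (t ++ s') (Or.inr ⟨t, ht, s', hs', rfl⟩)
        ((List.prefix_append_right_inj t).2 hss')
  · rintro ⟨t, ht, s, hs, rfl⟩
    refine ⟨Or.inr ⟨t, ht, s, hs.1, rfl⟩, fun u' hu' hpre => ?_⟩
    have hs0 : s ≠ [] := fun h => hR.1 (h ▸ hs.1)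
    rcases hu' with hu' | ⟨t', ht', s', hs', rfl⟩
    · exfalso
      have h1 := ht.2 u' hu' ((List.prefix_append t s).trans hpre)
      rw [h1] at hpre
      have := hpre.length_le
      simp at this
      exact hs0 this
    · obtain ⟨rfl, h⟩ := prefix_of_maxElems ht ht' hpre
      rw [hs.2 s' hs' h]

theorem IsBTree.graft {T R : Set (List Λ)} (hT : IsBTree T) (hR : IsBTree R) :
    IsBTree (graft T R) := by
  refine ⟨?_, ?_⟩
  · rintro (h | ⟨t, ht, s, hs, h⟩)
    · exact hT.1 h
    · obtain ⟨rfl, rfl⟩ := List.append_eq_nil_iff.1 h.symm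
      exact hR.1 hs
  · rintro u hu v hv hvu
    rcases hu with hu | ⟨t, ht, s, hs, rfl⟩
    · exact Or.inl (hT.2 u hu v hv hvu)
    · rcases List.prefix_or_prefix_of_prefix hvu (List.prefix_append t s) with h | ⟨s', rfl⟩
      · exact Or.inl (hT.2 t ht.1 v hv h)
      · have hs' := (List.prefix_append_right_inj t).1 hvu
        rcases eq_or_ne s' [] with rfl | h0
        · rw [List.append_nil]
          exact Or.inl ht.1
        · exact Or.inr ⟨t, ht, s', hR.2 s hs s' h0 hs', rfl⟩

/-- The list of weights and vectors along the branch `t`. -/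
def branchRun (w : List (Λ × Set X) → ℝ) (x : List (Λ × Set X) → X) (t : List (Λ × Set X)) :
    List (ℝ × X) :=
  (List.range t.length).map fun k => (w (t.take (k + 1)), x (t.take (k + 1)))

theorem branchRun_congr {w w' : List (Λ × Set X) → ℝ} {x x' : List (Λ × Set X) → X}
    {t : List (Λ × Set X)} (h : ∀ s, s ≠ [] → s <+: t → w s = w' s ∧ x s = x' s) :
    branchRun w x t = branchRun w' x' t := by
  refine List.map_congr_left fun k hk => ?_
  rw [List.mem_range] at hk
  have h1 : t.take (k + 1) ≠ [] := by
    rw [← List.length_pos_iff, List.length_take]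
    omega
  obtain ⟨h2, h3⟩ := h _ h1 (List.take_prefix _ _)
  rw [h2, h3]

theorem branchRun_append (w : List (Λ × Set X) → ℝ) (x : List (Λ × Set X) → X)
    (t s : List (Λ × Set X)) :
    branchRun w x (t ++ s) =
      branchRun w x t ++ branchRun (fun u => w (t ++ u)) (fun u => x (t ++ u)) s := by
  rw [branchRun, branchRun, branchRun, List.length_append, List.range_add, List.map_append,
    List.map_map]
  congr 1
  · refine List.map_congr_left fun k hk => ?_
    rw [List.mem_range] at hk
    rw [List.take_append_of_le_length (by omega)]
  · refine List.map_congr_left fun k _ => ?_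
    simp only [Function.comp_apply]
    rw [add_assoc, List.take_length_add_append]

/-- There is a normally weakly null collection in `K` indexed by `T` such that the runs along all
maximal branches satisfy `Φ`. -/
def HasCollection (K : Set X) (T : Set (List (Λ × Set X))) (w : List (Λ × Set X) → ℝ)
    (Φ : List (ℝ × X) → Prop) : Prop :=
  ∃ x : List (Λ × Set X) → X, (∀ t a, t ++ [a] ∈ T → x (t ++ [a]) ∈ a.2) ∧ (∀ t ∈ T, x t ∈ K) ∧
    ∀ t ∈ maxElems T, Φ (branchRun w x t)

theorem hasCollection_congr {K : Set X} {T : Set (List (Λ × Set X))} (hT : IsBTree T)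
    {w w' : List (Λ × Set X) → ℝ} (hw : ∀ t ∈ T, w t = w' t) (Φ : List (ℝ × X) → Prop) :
    HasCollection K T w Φ ↔ HasCollection K T w' Φ := by
  have key : ∀ x, ∀ t ∈ maxElems T, branchRun w x t = branchRun w' x t := fun x t ht =>
    branchRun_congr fun s hs hst => ⟨hw s (hT.2 t ht.1 s hs hst), rfl⟩
  constructor
  · rintro ⟨x, h1, h2, h3⟩
    exact ⟨x, h1, h2, fun t ht => key x t ht ▸ h3 t ht⟩
  · rintro ⟨x, h1, h2, h3⟩
    exact ⟨x, h1, h2, fun t ht => (key x t ht).symm ▸ h3 t ht⟩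

theorem hasCollection_scale (K : Set X) (T : Set (List (Λ × Set X)))
    (w : List (Λ × Set X) → ℝ) (n : ℕ) (Φ : List (ℝ × X) → Prop) :
    HasCollection K T (fun t => w t / ((n : ℝ) + 1)) Φ ↔
      HasCollection K T w fun r => Φ (scale n r) := by
  simp [HasCollection, scale, branchRun, Function.comp_def]

/-- Past each maximal branch of `T` the collection on the copy of `R` may be chosen independently,
which is exactly a nesting of quantifiers. -/
theorem hasCollection_graft {K : Set X} {T R : Set (List (Λ × Set X))} (hT : IsBTree T)
    (hR : IsBTree R) (hne : R.Nonempty) {w w' : List (Λ × Set X) → ℝ}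
    (hw : ∀ t ∈ maxElems T, ∀ s ∈ R, w (t ++ s) = w' s) (Φ : List (ℝ × X) → Prop) :
    HasCollection K (graft T R) w Φ ↔
      HasCollection K T w fun r => HasCollection K R w' fun r' => Φ (r ++ r') := by
  classical
  constructor
  · rintro ⟨x, h1, h2, h3⟩
    refine ⟨x, fun t a h => h1 t a (Or.inl h), fun t h => h2 t (Or.inl h), fun t ht =>
      ⟨fun s => x (t ++ s), fun s a h => ?_, fun s h => h2 _ (Or.inr ⟨t, ht, s, h, rfl⟩),
        fun s hs => ?_⟩⟩
    · simp only [← List.append_assoc]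
      exact h1 _ a (Or.inr ⟨t, ht, _, h, List.append_assoc _ _ _⟩)
    · have := h3 _ ((mem_maxElems_graft hR hne).2 ⟨t, ht, s, hs, rfl⟩)
      rwa [branchRun_append, branchRun_congr (w' := w') (x' := fun u => x (t ++ u))
        fun u hu hus => ⟨hw t ht u (hR.2 s hs.1 u hu hus), rfl⟩] at this
  · rintro ⟨x, h1, h2, h3⟩
    have h4 : ∀ t, ∃ y : List (Λ × Set X) → X, t ∈ maxElems T →
        (∀ s a, s ++ [a] ∈ R → y (s ++ [a]) ∈ a.2) ∧ (∀ s ∈ R, y s ∈ K) ∧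
        ∀ s ∈ maxElems R, Φ (branchRun w x t ++ branchRun w' y s) := fun t => by
      by_cases ht : t ∈ maxElems T
      · obtain ⟨y, hy⟩ := h3 t ht
        exact ⟨y, fun _ => hy⟩
      · exact ⟨x, fun h => (ht h).elim⟩
    choose y hy using h4
    -- The glued collection is well defined: a decomposition into a maximal member of `T` and a
    -- member of `R` is unique, and no such concatenation lies in `T`.
    let z : List (Λ × Set X) → X := fun u =>
      if h : ∃ p : List (Λ × Set X) × List (Λ × Set X), p.1 ∈ maxElems T ∧ p.2 ∈ R ∧
        u = p.1 ++ p.2 then y h.choose.1 h.choose.2 else x u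
    have hne' : ∀ s ∈ R, s ≠ [] := fun s hs h => hR.1 (h ▸ hs)
    have hz1 : ∀ t ∈ T, z t = x t := fun t ht => dif_neg fun ⟨p, hp1, hp2, hp⟩ =>
      append_notMem_of_maxElems hp1 (hne' _ hp2) (hp ▸ ht)
    have hz2 : ∀ t ∈ maxElems T, ∀ s ∈ R, z (t ++ s) = y t s := fun t ht s hs => by
      have h : ∃ p : List (Λ × Set X) × List (Λ × Set X), p.1 ∈ maxElems T ∧ p.2 ∈ R ∧
        t ++ s = p.1 ++ p.2 := ⟨(t, s), ht, hs, rfl⟩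
      have e : z (t ++ s) = y h.choose.1 h.choose.2 := dif_pos h
      obtain ⟨hc1, hc2, hc⟩ := h.choose_spec
      obtain ⟨e1, -⟩ := prefix_of_maxElems ht hc1 (by rw [← hc])
      have e2 : s = h.choose.2 := by
        rw [← e1] at hc
        exact List.append_cancel_left hc
      rw [e, ← e1, ← e2]
    refine ⟨z, fun u a h => ?_, fun u hu => ?_, fun u hu => ?_⟩
    · rcases h with h | ⟨t, ht, s, hs, he⟩
      · rw [hz1 _ h]
        exact h1 u a h
      · rw [he, hz2 t ht s hs]
        rcases s.eq_nil_or_concat' with rfl | ⟨s', b, rfl⟩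
        · exact (hR.1 hs).elim
        · rw [← List.append_assoc] at he
          obtain rfl : a = b := by simpa using (List.append_inj' he rfl).2
          exact (hy t ht).1 s' a hs
    · rcases hu with hu | ⟨t, ht, s, hs, rfl⟩
      · rw [hz1 _ hu]
        exact h2 u hu
      · rw [hz2 t ht s hs]
        exact (hy t ht).2.1 s hs
    · obtain ⟨t, ht, s, hs, rfl⟩ := (mem_maxElems_graft hR hne).1 hu
      have := (hy t ht).2.2 s hs
      rw [branchRun_append]
      rwa [branchRun_congr (w' := w) (x' := x)
          fun u hu hut => ⟨rfl, hz1 u (hT.2 t ht.1 u hu hut)⟩,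
        branchRun_congr (w' := w') (x' := y t) fun u hu hus =>
          have hu' := hR.2 s hs.1 u hu hus
          ⟨hw t ht u hu', hz2 t ht u hu'⟩]

/-- Members of different trees are incomparable, so the maximal branches of the union are those of
the parts and collections on the parts can be glued. -/
theorem hasCollection_iUnion [Nonempty X] {ι : Sort*} {K : Set X} {T : ι → Set (List (Λ × Set X))}
    (hT : ∀ i, IsBTree (T i)) (hdisj : ∀ i j s t, s ∈ T i → t ∈ T j → s <+: t → i = j)
    (w : List (Λ × Set X) → ℝ) (Φ : List (ℝ × X) → Prop) :
    HasCollection K (⋃ i, T i) w Φ ↔ ∀ i, HasCollection K (T i) w Φ := by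
  classical
  have hmax : ∀ i, ∀ t, t ∈ maxElems (T i) ↔ t ∈ T i ∧ t ∈ maxElems (⋃ i, T i) := by
    refine fun i t => ⟨fun ht => ⟨ht.1, Set.mem_iUnion.2 ⟨i, ht.1⟩, fun s hs hts => ?_⟩,
      fun ht => ⟨ht.1, fun s hs => ht.2.2 s (Set.mem_iUnion.2 ⟨i, hs⟩)⟩⟩
    obtain ⟨j, hj⟩ := Set.mem_iUnion.1 hs
    obtain rfl := hdisj i j t s ht.1 hj hts
    exact ht.2 s hj hts
  constructor
  · rintro ⟨x, h1, h2, h3⟩ i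
    exact ⟨x, fun t a h => h1 t a (Set.mem_iUnion.2 ⟨i, h⟩),
      fun t h => h2 t (Set.mem_iUnion.2 ⟨i, h⟩), fun t ht => h3 t ((hmax i t).1 ht).2⟩
  · intro h
    choose x h1 h2 h3 using h
    let z : List (Λ × Set X) → X := fun t =>
      if h : ∃ i, t ∈ T i then x h.choose t else Classical.arbitrary X
    have hz : ∀ i, ∀ t ∈ T i, z t = x i t := fun i t ht => by
      have h : ∃ i, t ∈ T i := ⟨i, ht⟩
      rw [show z t = x h.choose t from dif_pos h,
        hdisj _ _ t t h.choose_spec ht List.prefix_rfl]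
    refine ⟨z, fun t a h => ?_, fun t h => ?_, fun t ht => ?_⟩
    · obtain ⟨i, hi⟩ := Set.mem_iUnion.1 h
      rw [hz i _ hi]
      exact h1 i t a hi
    · obtain ⟨i, hi⟩ := Set.mem_iUnion.1 h
      rw [hz i _ hi]
      exact h2 i t hi
    · obtain ⟨i, hi⟩ := Set.mem_iUnion.1 ht.1
      have := h3 i t ((hmax i t).2 ⟨hi, ht⟩)
      rwa [branchRun_congr (w' := w) (x' := x i)
        fun s hs hst => ⟨rfl, hz i s ((hT i).2 t hi s hs hst)⟩]

theorem hasCollection_image {K : Set X} {T : Set (List (Λ × Set X))} {f g : Λ → Λ}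
    (hgf : ∀ a, g (f a) = a) (w : List (Λ × Set X) → ℝ) (Φ : List (ℝ × X) → Prop) :
    HasCollection K (List.map (Prod.map f id) '' T) w Φ ↔
      HasCollection K T (fun t => w (t.map (Prod.map f id))) Φ := by
  have hinv : ∀ t : List (Λ × Set X), (t.map (Prod.map f id)).map (Prod.map g id) = t := by
    intro t
    have : Prod.map g id ∘ Prod.map f id = (id : Λ × Set X → Λ × Set X) := by
      ext a <;> simp [hgf]
    rw [List.map_map, this, List.map_id]
  have hmax : ∀ t : List (Λ × Set X),
      t.map (Prod.map f id) ∈ maxElems (List.map (Prod.map f id) '' T) ↔ t ∈ maxElems T := by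
    intro t
    constructor
    · rintro ⟨⟨t', ht', he⟩, h⟩
      have he' := congrArg (List.map (Prod.map g id)) he
      rw [hinv, hinv] at he'
      subst he'
      refine ⟨ht', fun s hs hts => ?_⟩
      have := congrArg (List.map (Prod.map g id)) (h _ ⟨s, hs, rfl⟩ (hts.map _))
      rwa [hinv, hinv] at this
    · rintro ⟨ht, h⟩
      refine ⟨⟨t, ht, rfl⟩, ?_⟩
      rintro _ ⟨s, hs, rfl⟩ hts
      have := hts.map (Prod.map g id)
      rw [hinv, hinv] at this
      rw [h s hs this]
  have hrun : ∀ (x : List (Λ × Set X) → X) (t : List (Λ × Set X)),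
      branchRun w x (t.map (Prod.map f id)) =
        branchRun (fun t => w (t.map (Prod.map f id))) (fun t => x (t.map (Prod.map f id))) t := by
    intro x t
    simp [branchRun, List.map_take]
  constructor
  · rintro ⟨x, h1, h2, h3⟩
    refine ⟨fun t => x (t.map (Prod.map f id)), fun t a h => ?_, fun t h => h2 _ ⟨t, h, rfl⟩,
      fun t ht => ?_⟩
    · have := h1 (t.map (Prod.map f id)) (Prod.map f id a) ⟨_, h, by simp⟩
      simpa using this
    · rw [← hrun]
      exact h3 _ ((hmax t).2 ht)
  · rintro ⟨x, h1, h2, h3⟩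
    refine ⟨fun t => x (t.map (Prod.map g id)), ?_, ?_, ?_⟩
    · rintro u a ⟨s, hs, he⟩
      have he' := congrArg (List.map (Prod.map g id)) he
      rw [hinv] at he'
      subst he'
      simp only [List.map_append, List.map_cons, List.map_nil] at hs ⊢
      exact h1 _ _ hs
    · rintro _ ⟨s, hs, rfl⟩
      simp only [hinv]
      exact h2 s hs
    · rintro u ⟨⟨s, hs, rfl⟩, hu⟩
      rw [hrun]
      simp only [hinv]
      exact h3 s ((hmax s).1 ⟨⟨s, hs, rfl⟩, hu⟩)

/-- The members of `G` with sets from `D` attached to their terms. -/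
def pairs (G : Set (List Λ)) (D : Set (Set X)) : Set (List (Λ × Set X)) :=
  {t | t.map Prod.fst ∈ G ∧ ∀ a ∈ t, a.2 ∈ D}

theorem IsBTree.pairs {G : Set (List Λ)} (hG : IsBTree G) (D : Set (Set X)) :
    IsBTree (pairs G D) := by
  refine ⟨fun h => hG.1 (by simpa using h.1), fun t ht s hs hst => ⟨?_, ?_⟩⟩
  · exact hG.2 _ ht.1 _ (by simpa using hs) (hst.map _)
  · exact fun a ha => ht.2 a (hst.subset ha)

theorem mem_maxElems_pairs {G : Set (List Λ)} {D : Set (Set X)} (hD : D.Nonempty)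
    {t : List (Λ × Set X)} :
    t ∈ maxElems (pairs G D) ↔ t ∈ pairs G D ∧ t.map Prod.fst ∈ maxElems G := by
  constructor
  · rintro ⟨ht, h⟩
    refine ⟨ht, ht.1, ?_⟩
    rintro _ hs ⟨s, rfl⟩
    obtain ⟨U, hU⟩ := hD
    have := h (t ++ s.map fun a => (a, U)) ⟨by simpa [Function.comp_def] using hs, fun a ha => by
      rcases List.mem_append.1 ha with ha | ha
      · exact ht.2 a ha
      · obtain ⟨b, -, rfl⟩ := List.mem_map.1 ha
        exact hU⟩ (List.prefix_append _ _)
    simpa using this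
  · rintro ⟨ht, ht', h⟩
    refine ⟨ht, fun s hs hts => ?_⟩
    have h1 := congrArg List.length (h _ hs.1 (hts.map _))
    simp only [List.length_map] at h1
    exact (hts.eq_of_length h1.symm).symm

theorem pairs_graft (G H : Set (List Λ)) {D : Set (Set X)} (hD : D.Nonempty) :
    pairs (graft G H) D = graft (pairs G D) (pairs H D) := by
  ext u
  constructor
  · rintro ⟨h | ⟨t, ht, s, hs, he⟩, hu⟩
    · exact Or.inl ⟨h, hu⟩
    · obtain ⟨t', s', rfl, rfl, rfl⟩ := List.map_eq_append_iff.1 he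
      have ht' : ∀ a ∈ t', a.2 ∈ D := fun a ha => hu a (by simp [ha])
      exact Or.inr ⟨t', (mem_maxElems_pairs hD).2 ⟨⟨ht.1, ht'⟩, ht⟩, s',
        ⟨hs, fun a ha => hu a (by simp [ha])⟩, rfl⟩
  · rintro (⟨h, hu⟩ | ⟨t, ht, s, hs, rfl⟩)
    · exact ⟨Or.inl h, hu⟩
    · rw [mem_maxElems_pairs hD] at ht
      refine ⟨Or.inr ⟨_, ht.2, _, hs.1, by simp⟩, fun a ha => ?_⟩
      rcases List.mem_append.1 ha with ha | ha
      exacts [ht.1.2 a ha, hs.2 a ha]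

theorem pairs_iUnion {ι : Sort*} (G : ι → Set (List Λ)) (D : Set (Set X)) :
    pairs (⋃ i, G i) D = ⋃ i, pairs (G i) D := by
  ext u
  simp [pairs]

theorem pairs_image (f : Λ → Λ) (G : Set (List Λ)) (D : Set (Set X)) :
    pairs (List.map f '' G) D = List.map (Prod.map f id) '' pairs G D := by
  ext u
  constructor
  · rintro ⟨⟨s, hs, he⟩, hu⟩
    refine ⟨s.zip (u.map Prod.snd), ⟨?_, ?_⟩, ?_⟩
    · have hl := congrArg List.length he
      rw [List.length_map, List.length_map] at hl
      rwa [List.map_fst_zip (by simp [hl])]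
    · rintro ⟨a, U⟩ ha
      obtain ⟨b, hb, hb'⟩ := List.mem_map.1 (List.of_mem_zip ha).2
      exact hb' ▸ hu b hb
    · rw [← List.zip_map, he, List.map_id]
      exact (List.zip_of_prod rfl rfl).symm
  · rintro ⟨s, hs, rfl⟩
    refine ⟨⟨_, hs.1, by simp⟩, fun a ha => ?_⟩
    obtain ⟨b, hb, rfl⟩ := List.mem_map.1 ha
    exact hs.2 b hb

end Collections

/-! ### Decoding levels and components of `Γ_ξ` from the ordinals. -/

section SpecialTreeStructure

theorem gam_zero : Gam (0 : Ordinal.{v}) = {[0]} := by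
  rw [Gam, Ordinal.limitRecOn_zero]

theorem gam_add_one (ξ : Ordinal.{v}) : Gam (ξ + 1) = ⋃ n : ℕ, GamN ξ (n + 1) := by
  rw [Gam, Ordinal.limitRecOn_add_one]; rfl

theorem gam_limit {ξ : Ordinal.{v}} (hξ : Order.IsSuccLimit ξ) :
    Gam ξ = ⋃ ζ : Set.Iio ξ, shift (Ordinal.omega0 ^ (ζ : Ordinal.{v})) (Gam (ζ + 1)) := by
  rw [Gam, Ordinal.limitRecOn_limit _ _ _ _ hξ, Set.iUnion_subtype]; rfl

theorem weight_zero (t : List Ordinal.{v}) : weight 0 t = 1 := by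
  rw [weight, Ordinal.limitRecOn_zero]

theorem weight_add_one (ξ : Ordinal.{v}) (t : List Ordinal.{v}) :
    weight (ξ + 1) t = weight ξ (iota ξ t) /
      ((Cardinal.toNat (t.headD 0 / Ordinal.omega0 ^ ξ).card : ℝ) + 1) := by
  rw [weight, Ordinal.limitRecOn_add_one]; rfl

theorem weight_limit {ξ : Ordinal.{v}} (hξ : Order.IsSuccLimit ξ) (t : List Ordinal.{v})
    (h : Ordinal.log Ordinal.omega0 (t.headD 0) < ξ) :
    weight ξ t = weight (Ordinal.log Ordinal.omega0 (t.headD 0) + 1)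
      (t.map (fun a => a - Ordinal.omega0 ^ Ordinal.log Ordinal.omega0 (t.headD 0))) := by
  rw [weight, Ordinal.limitRecOn_limit _ _ _ _ hξ, dif_pos h]; rfl

theorem IsBTree.shift {G : Set (List Ordinal.{v})} (hG : IsBTree G) (β : Ordinal.{v}) :
    IsBTree (shift β G) := by
  refine ⟨?_, ?_⟩
  · rintro ⟨s, hs, he⟩
    rw [List.map_eq_nil_iff] at he
    exact hG.1 (he ▸ hs)
  · rintro _ ⟨s, hs, rfl⟩ u hu hpre
    obtain ⟨s', hs', rfl⟩ := List.prefix_map_iff.1 hpre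
    exact ⟨s', hG.2 s hs s' (by simpa using hu) hs', rfl⟩

theorem IsBTree.iUnion {Λ : Type w} {ι : Sort*} {G : ι → Set (List Λ)} (hG : ∀ i, IsBTree (G i)) :
    IsBTree (⋃ i, G i) := by
  refine ⟨fun h => ?_, fun t ht s hs hst => ?_⟩
  · obtain ⟨i, hi⟩ := Set.mem_iUnion.1 h
    exact (hG i).1 hi
  · obtain ⟨i, hi⟩ := Set.mem_iUnion.1 ht
    exact Set.mem_iUnion.2 ⟨i, (hG i).2 t hi s hs hst⟩

theorem headD_eq_of_prefix {Λ : Type w} {s t : List Λ} (hs : s ≠ []) (h : s <+: t) (d : Λ) :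
    s.headD d = t.headD d := by
  obtain ⟨r, rfl⟩ := h
  cases s with
  | nil => exact (hs rfl).elim
  | cons a s => rfl

theorem levels_add_one (α : Ordinal.{v}) (G : Set (List Ordinal.{v})) (n : ℕ) :
    levels α G (n + 1) = graft (shift (α * n) G) (levels α G n) := rfl

/-- `G` is a non-empty `B`-tree on `[0, α)`. -/
structure IsTreeBelow (α : Ordinal.{v}) (G : Set (List Ordinal.{v})) : Prop where
  isBTree : IsBTree G
  nonempty : G.Nonempty
  lt : ∀ t ∈ G, ∀ a ∈ t, a < α

namespace IsTreeBelow

variable {α : Ordinal.{v}} {G : Set (List Ordinal.{v})}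

theorem levels_isBTree (hG : IsTreeBelow α G) (n : ℕ) : IsBTree (levels α G n) := by
  induction n with
  | zero => exact ⟨fun h => h, fun t ht => ht.elim⟩
  | succ n ih =>
    rw [levels_add_one]
    exact (hG.isBTree.shift _).graft ih

theorem levels_nonempty (hG : IsTreeBelow α G) (n : ℕ) : (levels α G (n + 1)).Nonempty := by
  obtain ⟨t, ht⟩ := hG.nonempty
  exact ⟨_, Or.inl ⟨t, ht, rfl⟩⟩

theorem shift_div (hG : IsTreeBelow α G) {n : ℕ} {t : List Ordinal.{v}}
    (ht : t ∈ shift (α * n) G) {a : Ordinal.{v}} (ha : a ∈ t) : a / α = n := by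
  obtain ⟨s, hs, rfl⟩ := ht
  obtain ⟨b, hb, rfl⟩ := List.mem_map.1 ha
  have h := hG.lt s hs b hb
  rw [Ordinal.mul_add_div _ (ne_bot_of_gt h), Ordinal.div_eq_zero_of_lt h, add_zero]

theorem levels_div (hG : IsTreeBelow α G) {n : ℕ} {t : List Ordinal.{v}}
    (ht : t ∈ levels α G n) {a : Ordinal.{v}} (ha : a ∈ t) : ∃ k < n, a / α = k := by
  induction n generalizing t with
  | zero => exact ht.elim
  | succ n ih =>
    rcases ht with ht | ⟨r, hr, s, hs, rfl⟩
    · exact ⟨n, n.lt_succ_self, hG.shift_div ht ha⟩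
    · rcases List.mem_append.1 ha with ha | ha
      · exact ⟨n, n.lt_succ_self, hG.shift_div hr.1 ha⟩
      · obtain ⟨k, hk, he⟩ := ih hs ha
        exact ⟨k, hk.trans n.lt_succ_self, he⟩

theorem levels_lt (hG : IsTreeBelow α G) {n : ℕ} {t : List Ordinal.{v}}
    (ht : t ∈ levels α G n) {a : Ordinal.{v}} (ha : a ∈ t) : a < α * n := by
  obtain ⟨k, hk, he⟩ := hG.levels_div ht ha
  obtain ⟨s, hs⟩ := hG.nonempty
  have hα : α ≠ 0 := by
    rcases s with _ | ⟨b, s⟩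
    · exact (hG.isBTree.1 hs).elim
    · exact ne_bot_of_gt (hG.lt _ hs b (by simp))
  rw [Ordinal.lt_mul_iff_div_lt hα, he]
  exact_mod_cast hk

/-- The first term reveals the number of levels; this separates the parts of `Γ_(ξ+1)` and
identifies the denominator in `weight`. -/
theorem levels_headD (hG : IsTreeBelow α G) {n : ℕ} {t : List Ordinal.{v}}
    (ht : t ∈ levels α G (n + 1)) : t.headD 0 / α = n := by
  have key : ∀ s ∈ shift (α * n) G, s.headD 0 / α = n := by
    intro s hs
    rcases s with _ | ⟨a, s⟩
    · exact ((hG.isBTree.shift _).1 hs).elim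
    · exact hG.shift_div hs (by simp)
  rcases ht with ht | ⟨r, hr, s, hs, rfl⟩
  · exact key t ht
  · rw [← headD_eq_of_prefix (fun h => (hG.isBTree.shift _).1 (h ▸ hr.1))
      (List.prefix_append r s) 0]
    exact key r hr.1

theorem levels_disjoint (hG : IsTreeBelow α G) {m n : ℕ} {s t : List Ordinal.{v}}
    (hs : s ∈ levels α G (m + 1)) (ht : t ∈ levels α G (n + 1)) (h : s <+: t) : m = n := by
  have h1 := hG.levels_headD hs
  rw [headD_eq_of_prefix (fun h0 => (hG.levels_isBTree _).1 (h0 ▸ hs)) h 0,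
    hG.levels_headD ht] at h1
  exact_mod_cast h1.symm

end IsTreeBelow

/-- At limit ordinals, the logarithm of the first term recovers the component `ω ^ ζ + Γ_(ζ+1)`. -/
theorem log_opow_add {ζ a : Ordinal.{v}} (ha : a < Ordinal.omega0 ^ (ζ + 1)) :
    Ordinal.omega0 ^ ζ + a < Ordinal.omega0 ^ (ζ + 1) ∧
      Ordinal.log Ordinal.omega0 (Ordinal.omega0 ^ ζ + a) = ζ := by
  have h1 : Ordinal.omega0 ^ ζ + a < Ordinal.omega0 ^ (ζ + 1) :=
    Ordinal.isPrincipal_add_omega0_opow _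
      ((Ordinal.opow_lt_opow_iff_right Ordinal.one_lt_omega0).2 (Order.lt_add_one_iff.2 le_rfl)) ha
  refine ⟨h1, (Ordinal.log_eq_iff Ordinal.one_lt_omega0 ?_ ζ).2 ⟨le_self_add, h1⟩⟩
  exact ((Ordinal.opow_pos ζ Ordinal.omega0_pos).trans_le le_self_add).ne'

theorem shift_headD {G : Set (List Ordinal.{v})} {ζ : Ordinal.{v}}
    (hG : IsTreeBelow (Ordinal.omega0 ^ (ζ + 1)) G) {t : List Ordinal.{v}}
    (ht : t ∈ shift (Ordinal.omega0 ^ ζ) G) : Ordinal.log Ordinal.omega0 (t.headD 0) = ζ := by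
  obtain ⟨s, hs, rfl⟩ := ht
  rcases s with _ | ⟨a, s⟩
  · exact (hG.isBTree.1 hs).elim
  · exact (log_opow_add (hG.lt _ hs a (by simp))).2

theorem shift_disjoint {G H : Set (List Ordinal.{v})} {ζ η : Ordinal.{v}}
    (hG : IsTreeBelow (Ordinal.omega0 ^ (ζ + 1)) G) (hH : IsTreeBelow (Ordinal.omega0 ^ (η + 1)) H)
    {s t : List Ordinal.{v}} (hs : s ∈ shift (Ordinal.omega0 ^ ζ) G)
    (ht : t ∈ shift (Ordinal.omega0 ^ η) H) (h : s <+: t) : ζ = η := by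
  rw [← shift_headD hG hs, ← shift_headD hH ht,
    headD_eq_of_prefix (fun h0 => (hG.isBTree.shift _).1 (h0 ▸ hs)) h 0]

theorem gam_isTreeBelow (ξ : Ordinal.{v}) : IsTreeBelow (Ordinal.omega0 ^ ξ) (Gam ξ) := by
  induction ξ using Ordinal.limitRecOn with
  | zero =>
    rw [gam_zero]
    refine ⟨⟨by simp, ?_⟩, ⟨_, rfl⟩, by simp⟩
    rintro _ rfl s hs h
    rcases List.prefix_cons_iff.1 h with rfl | ⟨s', rfl, hs'⟩
    · exact (hs rfl).elim
    · rw [List.prefix_nil.1 hs']; rfl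
  | add_one ξ ih =>
    rw [gam_add_one]
    refine ⟨IsBTree.iUnion fun n => ih.levels_isBTree _, ?_, fun t ht a ha => ?_⟩
    · obtain ⟨t, ht⟩ := ih.levels_nonempty 0
      exact ⟨t, Set.mem_iUnion.2 ⟨0, ht⟩⟩
    · obtain ⟨n, hn⟩ := Set.mem_iUnion.1 ht
      refine (ih.levels_lt hn ha).trans ?_
      rw [Ordinal.opow_add_one]
      exact mul_lt_mul_of_pos_left (Ordinal.natCast_lt_omega0 _)
        (Ordinal.opow_pos _ Ordinal.omega0_pos)
  | limit ξ hξ ih =>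
    rw [gam_limit hξ]
    have h1 := fun ζ : Set.Iio ξ => ih _ (hξ.add_one_lt ζ.2)
    refine ⟨IsBTree.iUnion fun ζ => (h1 ζ).isBTree.shift _, ?_, fun t ht a ha => ?_⟩
    · obtain ⟨t, ht⟩ := (h1 ⟨0, hξ.bot_lt⟩).nonempty
      exact ⟨_, Set.mem_iUnion.2 ⟨⟨0, hξ.bot_lt⟩, t, ht, rfl⟩⟩
    · obtain ⟨ζ, s, hs, rfl⟩ := Set.mem_iUnion.1 ht
      obtain ⟨b, hb, rfl⟩ := List.mem_map.1 ha
      exact (log_opow_add ((h1 ζ).lt s hs b hb)).1.trans_le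
        (Ordinal.opow_le_opow_right Ordinal.omega0_pos (hξ.add_one_lt ζ.2).le)

theorem iota_shift {ξ : Ordinal.{v}} {n : ℕ} {t : List Ordinal.{v}} (ht : t ∈ Gam ξ) :
    iota ξ (t.map fun a => Ordinal.omega0 ^ ξ * n + a) = t := by
  classical
  have hG := gam_isTreeBelow ξ
  have ht' : (t.map fun a => Ordinal.omega0 ^ ξ * n + a) ∈
    shift (Ordinal.omega0 ^ ξ * n) (Gam ξ) := ⟨t, ht, rfl⟩
  have hne : (t.map fun a => Ordinal.omega0 ^ ξ * (n : Ordinal.{v}) + a) ≠ [] :=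
    fun h => (hG.isBTree.shift _).1 (h ▸ ht')
  rw [iota, List.filter_eq_self.2, List.map_map]
  · conv_rhs => rw [← List.map_id t]
    refine List.map_congr_left fun a ha => ?_
    simp only [Function.comp_apply, id]
    rw [Ordinal.mul_add_mod_self, Ordinal.mod_eq_of_lt (hG.lt t ht a ha)]
  · intro a ha
    rw [List.getLastD_eq_getLast?, List.getLast?_eq_some_getLast hne, Option.getD_some,
      hG.shift_div ht' ha, hG.shift_div ht' (List.getLast_mem hne)]
    simp

/-- Terms of the first level have quotient `n` by `ω ^ ξ`, later ones a smaller quotient, so the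
filter discards `t`. -/
theorem iota_append {ξ : Ordinal.{v}} {n : ℕ} {t s : List Ordinal.{v}}
    (ht : t ∈ shift (Ordinal.omega0 ^ ξ * n) (Gam ξ)) (hs : s ∈ GamN ξ n) :
    iota ξ (t ++ s) = iota ξ s := by
  classical
  have hG := gam_isTreeBelow ξ
  have hne : s ≠ [] := fun h => (hG.levels_isBTree n).1 (h ▸ hs)
  have hlast : (t ++ s).getLastD 0 = s.getLast hne := by
    rw [List.getLastD_eq_getLast?, List.getLast?_append_of_ne_nil _ hne,
      List.getLast?_eq_some_getLast hne, Option.getD_some]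
  have hlast' : s.getLastD 0 = s.getLast hne := by
    rw [List.getLastD_eq_getLast?, List.getLast?_eq_some_getLast hne, Option.getD_some]
  rw [iota, iota, hlast, hlast', List.filter_append, List.filter_eq_nil_iff.2, List.nil_append]
  intro a ha
  obtain ⟨k, hk, he⟩ := hG.levels_div hs (List.getLast_mem hne)
  rw [hG.shift_div ht ha, he]
  simpa using hk.ne'

end SpecialTreeStructure

/-! ### Collections on the special trees are strategies. -/

section Correspondence

variable {X : Type u} {K : Set X} {D : Set (Set X)} {F : Filter X}

theorem hasCollection_shift {ξ : Ordinal.{v}} (n : ℕ) (Φ : List (ℝ × X) → Prop) :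
    HasCollection K (pairs (shift (Ordinal.omega0 ^ ξ * n) (Gam ξ)) D)
        (fun u => weight ξ (iota ξ (u.map Prod.fst))) Φ ↔
      HasCollection K (pairs (Gam ξ) D) (fun u => weight ξ (u.map Prod.fst)) Φ := by
  have hG := gam_isTreeBelow ξ
  rw [shift, pairs_image, hasCollection_image (g := fun a => a - Ordinal.omega0 ^ ξ * n)
    (fun a => Ordinal.add_sub_cancel _ _)]
  refine hasCollection_congr (hG.isBTree.pairs D) (fun t ht => ?_) Φ
  rw [← iota_shift (n := n) ht.1]
  simp [Function.comp_def]

theorem hasCollection_gamN (hD : D.Nonempty) {ξ : Ordinal.{v}}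
    (ih : ∀ Φ : List (ℝ × X) → Prop,
      HasCollection K (pairs (Gam ξ) D) (fun u => weight ξ (u.map Prod.fst)) Φ ↔ Strat F ξ Φ)
    (n : ℕ) (Φ : List (ℝ × X) → Prop) :
    HasCollection K (pairs (GamN ξ (n + 1)) D) (fun u => weight ξ (iota ξ (u.map Prod.fst))) Φ ↔
      iter (Strat F ξ) (n + 1) Φ := by
  have hG := gam_isTreeBelow ξ
  induction n generalizing Φ with
  | zero =>
    have h1 : GamN ξ (0 + 1) = shift (Ordinal.omega0 ^ ξ * (0 : ℕ)) (Gam ξ) := by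
      rw [GamN, levels_add_one]
      simp [graft, levels]
    rw [h1, hasCollection_shift, ih]
    simp [iter]
  | succ n ihn =>
    rw [GamN, levels_add_one, pairs_graft _ _ hD, hasCollection_graft
      ((hG.isBTree.shift _).pairs D) ((hG.levels_isBTree _).pairs D) ?_
      (w' := fun u => weight ξ (iota ξ (u.map Prod.fst))), hasCollection_shift, ih]
    · have h2 := fun r => ihn fun r' => Φ (r ++ r')
      rw [GamN] at h2
      simp only [h2]
      rfl
    · intro t ht s hs
      rw [List.map_append, iota_append ht.1.1 hs.1]
    · obtain ⟨t, ht⟩ := hG.levels_nonempty n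
      obtain ⟨U, hU⟩ := hD
      refine ⟨t.map fun a => (a, U), by simpa [Function.comp_def] using ht, fun a ha => ?_⟩
      obtain ⟨b, -, rfl⟩ := List.mem_map.1 ha
      exact hU

/-- The recursion for `Γ_ξ` matches that for `Strat`. At `ξ = 0`, choosing a vector of `U ∩ K` for
each `U ∈ D` means that `Φ` holds frequently along `F`. -/
theorem hasCollection_gam [Nonempty X] (hF : F.HasBasis (· ∈ D) fun U => U ∩ K) (ξ : Ordinal.{v})
    (Φ : List (ℝ × X) → Prop) :
    HasCollection K (pairs (Gam ξ) D) (fun u => weight ξ (u.map Prod.fst)) Φ ↔ Strat F ξ Φ := by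
  classical
  have hD : D.Nonempty := hF.ex_mem
  induction ξ using Ordinal.limitRecOn generalizing Φ with
  | zero =>
    have hmem : ∀ t : List (Ordinal.{v} × Set X), t ∈ pairs (Gam 0) D ↔ ∃ U ∈ D, t = [(0, U)] := by
      intro t
      rw [pairs, gam_zero]
      constructor
      · rintro ⟨h1, h2⟩
        rcases t with _ | ⟨⟨a, U⟩, _ | ⟨b, t⟩⟩
        · simp at h1
        · obtain rfl : a = 0 := by simpa using h1
          exact ⟨U, h2 (0, U) (by simp), rfl⟩
        · simp at h1
      · rintro ⟨U, hU, rfl⟩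
        exact ⟨by simp, by simpa using hU⟩
    have hmax : ∀ t ∈ pairs (Gam (0 : Ordinal.{v})) D, t ∈ maxElems (pairs (Gam 0) D) := by
      refine fun t ht => ⟨ht, fun s hs hts => ?_⟩
      obtain ⟨U, -, rfl⟩ := (hmem t).1 ht
      obtain ⟨V, -, rfl⟩ := (hmem s).1 hs
      exact (hts.eq_of_length rfl).symm
    rw [strat_zero, hF.frequently_iff]
    constructor
    · rintro ⟨x, h1, h2, h3⟩ U hU
      have hU' := (hmem _).2 ⟨U, hU, rfl⟩
      refine ⟨x [(0, U)], ⟨h1 [] (0, U) hU', h2 _ hU'⟩, ?_⟩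
      simpa [branchRun, weight_zero] using h3 _ (hmax _ hU')
    · intro h
      choose! y hy using h
      refine ⟨fun t => y (t.headD (0, Set.univ)).2, ?_, ?_, ?_⟩
      · intro t a ht
        obtain ⟨U, hU, he⟩ := (hmem _).1 ht
        obtain ⟨rfl, rfl⟩ : t = [] ∧ a = (0, U) := by
          rcases t with _ | ⟨b, t⟩
          · simpa using he
          · simp at he
        exact (hy U hU).1.1
      · intro t ht
        obtain ⟨U, hU, rfl⟩ := (hmem _).1 ht
        exact (hy U hU).1.2
      · intro t ht
        obtain ⟨U, hU, rfl⟩ := (hmem _).1 ht.1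
        simpa [branchRun, weight_zero] using (hy U hU).2
  | add_one ξ ih =>
    have hG := gam_isTreeBelow ξ
    rw [gam_add_one, pairs_iUnion, hasCollection_iUnion
      (T := fun n => pairs (GamN ξ (n + 1)) D) (fun n => (hG.levels_isBTree _).pairs D), strat_add_one]
    · refine forall_congr' fun n => ?_
      rw [← hasCollection_gamN hD ih, ← hasCollection_scale]
      refine hasCollection_congr ((hG.levels_isBTree _).pairs D) (fun t ht => ?_) Φ
      rw [weight_add_one, hG.levels_headD ht.1, Ordinal.card_nat, Cardinal.toNat_natCast]
    · exact fun i j s t hs ht hst => hG.levels_disjoint hs.1 ht.1 (hst.map _)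
  | limit ξ hξ ih =>
    have hG := fun ζ => gam_isTreeBelow ζ
    rw [gam_limit hξ, pairs_iUnion, hasCollection_iUnion
      (fun ζ => ((hG _).isBTree.shift _).pairs D), strat_limit F hξ, Subtype.forall]
    · refine forall₂_congr fun ζ hζ => ?_
      refine Iff.trans ?_ (ih _ (hξ.add_one_lt hζ) Φ)
      rw [shift, pairs_image, hasCollection_image
        (g := fun a => a - Ordinal.omega0 ^ ζ) (fun a => Ordinal.add_sub_cancel _ _)]
      refine hasCollection_congr ((hG _).isBTree.pairs D) (fun t ht => ?_) Φ
      have h1 : (t.map (Prod.map (fun a => Ordinal.omega0 ^ ζ + a) id)).map Prod.fst =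
          (t.map Prod.fst).map fun a => Ordinal.omega0 ^ ζ + a := by
        simp [Function.comp_def]
      have h2 := shift_headD (hG _) (ζ := ζ) ⟨_, ht.1, rfl⟩
      rw [h1, weight_limit hξ _ (by rw [h2]; exact hζ), h2, List.map_map]
      congr 1
      conv_rhs => rw [← List.map_id (t.map Prod.fst)]
      refine List.map_congr_left fun a _ => ?_
      exact Ordinal.add_sub_cancel _ _
    · exact fun i j s t hs ht hst =>
        Subtype.ext (shift_disjoint (hG _) (hG _) hs.1 ht.1 (hst.map _))

end Correspondence

/-! ### Averages of the first `N` values. -/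

section Averages

variable {Y : Type u''} {R : Y → ℕ → ℝ}

/-- The average of the first `N` values. -/
def avg (R : Y → ℕ → ℝ) (N : ℕ) (y : Y) : ℝ := (1 / (N : ℝ)) * ∑ n ∈ Finset.range N, R y n

theorem avg_le_avg {R' : Y → ℕ → ℝ} {N : ℕ} {y y' : Y} {c : ℝ} (hN : 0 < N)
    (h : ∀ n < N, R y n ≤ R' y' n + c) : avg R N y ≤ avg R' N y' + c := by
  have hN' : (0 : ℝ) < N := by exact_mod_cast hN
  have h1 : ∑ n ∈ Finset.range N, R y n ≤ ∑ n ∈ Finset.range N, R' y' n + N * c := by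
    have := Finset.sum_le_sum fun n hn => h n (Finset.mem_range.1 hn)
    simpa [Finset.sum_add_distrib] using this
  have h2 := mul_le_mul_of_nonneg_left h1 (one_div_pos.2 hN').le
  rw [mul_add, ← mul_assoc, one_div_mul_cancel hN'.ne', one_mul] at h2
  exact h2

end Averages

/-! ### Convexity and one-step growth of game values. -/

section GameValues

variable {X : Type u} [NormedAddCommGroup X] [NormedSpace ℝ X]
  {Y : Type u''} [NormedAddCommGroup Y] [NormedSpace ℝ Y]

/-- `R y n` is the value of the `n`-fold game in which one player tries to make
`‖y + A (vsum r)‖` large. -/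
structure IsGameValue (F : Filter X) (ξ : Ordinal.{v}) (A : X →ₗ[ℝ] Y) (R : Y → ℕ → ℝ) :
    Prop where
  norm_le : ∀ x, ‖A x‖ ≤ ‖x‖
  bounded : ∀ᶠ x in F, ‖x‖ ≤ 1
  zero_frequently : ∃ᶠ x in F, x ∈ ({0} : Set X)
  iter_of_lt : ∀ {y n l}, l < R y n → iter (Strat F ξ) n fun r => l < ‖y + A (vsum r)‖
  le_of_iter : ∀ {y n l}, iter (Strat F ξ) n (fun r => l < ‖y + A (vsum r)‖) → l ≤ R y n

theorem vsum_eq_zero {r : List (ℝ × X)} (h : el r ⊆ {0}) : vsum r = 0 := by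
  refine List.sum_eq_zero fun x hx => ?_
  obtain ⟨p, hp, rfl⟩ := List.mem_map.1 hx
  have : p.2 = 0 := h ⟨p, hp, rfl⟩
  rw [this, smul_zero]

namespace IsGameValue

variable {F : Filter X} {ξ : Ordinal.{v}} {A : X →ₗ[ℝ] Y} {R : Y → ℕ → ℝ}

theorem apply_zero (h : IsGameValue F ξ A R) (y : Y) : R y 0 = ‖y‖ := by
  refine le_antisymm (le_of_forall_lt fun l hl => ?_) (le_of_forall_lt_imp_le_of_dense fun l hl => ?_)
  · simpa [iter] using h.iter_of_lt hl
  · exact h.le_of_iter (by simpa [iter] using hl)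

theorem strat_of_lt (h : IsGameValue F ξ A R) {y : Y} {n : ℕ} {l : ℝ} (hl : l < R y (n + 1)) :
    Strat F ξ fun r => l ≤ R (y + A (vsum r)) n := by
  have hQ := isStrat_strat F ξ
  refine hQ.mono (fun r hr => h.le_of_iter (hQ.iter_mono (fun r' hr' => ?_) hr)) (h.iter_of_lt hl)
  simpa [add_assoc] using hr'

theorem le_of_strat (h : IsGameValue F ξ A R) {y : Y} {n : ℕ} {l : ℝ}
    (hl : Strat F ξ fun r => l < R (y + A (vsum r)) n) : l ≤ R y (n + 1) := by
  have hQ := isStrat_strat F ξ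
  refine h.le_of_iter (hQ.mono (fun r hr => hQ.iter_mono (fun r' hr' => ?_) (h.iter_of_lt hr)) hl)
  simpa [add_assoc] using hr'

theorem le_add_norm_sub (h : IsGameValue F ξ A R) (y y' : Y) (n : ℕ) :
    R y n ≤ R y' n + ‖y - y'‖ := by
  have hQ := isStrat_strat F ξ
  rw [← sub_le_iff_le_add]
  refine le_of_forall_lt_imp_le_of_dense fun l hl => h.le_of_iter ?_
  refine hQ.iter_mono (fun r hr => ?_) (h.iter_of_lt (lt_sub_iff_add_lt.1 hl))
  have h1 := norm_add_le (y' + A (vsum r)) (y - y')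
  rw [show y' + A (vsum r) + (y - y') = y + A (vsum r) by abel] at h1
  linarith

/-- The player can always play zero vectors. -/
theorem norm_le_apply (h : IsGameValue F ξ A R) (y : Y) (n : ℕ) : ‖y‖ ≤ R y n := by
  have hQ := isStrat_strat F ξ
  refine le_of_forall_lt_imp_le_of_dense fun l hl => h.le_of_iter ?_
  refine hQ.iter_mono (fun r hr => ?_)
    (iter_frequently hQ (strat_frequently h.zero_frequently ξ) n)
  rwa [vsum_eq_zero hr, map_zero, add_zero]

/-- Among finitely many convex functions `R (y i + A ·) n i`, one is large along a strategy if the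
maximum of all of them is. -/
theorem exists_strat (h : IsGameValue F ξ A R) {ι : Type u} [Finite ι] (y : ι → Y) (n : ι → ℕ)
    (hconv : ∀ i, ConvexOn ℝ Set.univ fun y => R y (n i)) (l : ι → ℝ)
    (H : Strat F ξ fun r => ∃ i, l i ≤ R (y i + A (vsum r)) (n i)) {δ : ℝ} (hδ : 0 < δ) :
    ∃ i, l i - δ ≤ R (y i) (n i + 1) := by
  obtain ⟨i, hi⟩ := strat_exists_convex h.bounded ξ (fun i x => R (y i + A x) (n i))
    (fun i => by simpa [Function.comp_def] using
      ((hconv i).translate_right (y i)).comp_linearMap A)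
    (fun i x x' => by
      refine (h.le_add_norm_sub _ (y i + A x') _).trans ?_
      rw [add_sub_add_left_eq_sub, ← map_sub]
      gcongr
      exact h.norm_le _) l (half_pos hδ) H
  exact ⟨i, h.le_of_strat ((isStrat_strat F ξ).mono (fun r hr => by linarith) hi)⟩

/-- If convexity fails for `n + 1` moves, some first-move strategy makes the value for `n` moves at
`a • y + b • y' + Az` too large. By convexity for `n`, each of its runs is too good at `y + Az` or
at `y' + Az`; `exists_strat` fixes one of the two, which contradicts the value there. -/
theorem convexOn (h : IsGameValue F ξ A R) (n : ℕ) : ConvexOn ℝ Set.univ fun y => R y n := by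
  induction n with
  | zero =>
    simp only [h.apply_zero]
    exact convexOn_univ_norm
  | succ n ih =>
    refine ⟨convex_univ, fun y _ y' _ a b ha hb hab => ?_⟩
    simp only [smul_eq_mul]
    by_contra! hlt
    obtain ⟨δ, hδ, hlt⟩ : ∃ δ > 0, a * R y (n + 1) + b * R y' (n + 1) + 2 * δ <
        R (a • y + b • y') (n + 1) :=
      ⟨(R (a • y + b • y') (n + 1) - (a * R y (n + 1) + b * R y' (n + 1))) / 4,
        by linarith, by linarith⟩
    have H := h.strat_of_lt hlt
    obtain ⟨⟨i⟩, hi⟩ := h.exists_strat (ι := ULift.{u} Bool)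
      (fun i => if i.down then y else y') (fun _ => n) (fun _ => ih)
      (fun i => R (if i.down then y else y') (n + 1) + 2 * δ)
      ((isStrat_strat F ξ).mono (fun r hr => by
        by_contra! hcon
        have h1 := hcon ⟨true⟩
        have h2 := hcon ⟨false⟩
        simp only [if_true, Bool.false_eq_true, if_false] at h1 h2
        have h3 := ih.2 (Set.mem_univ (y + A (vsum r))) (Set.mem_univ (y' + A (vsum r))) ha hb hab
        -- Since `a + b = 1`, the same move `Az` serves both endpoints.
        rw [show a • (y + A (vsum r)) + b • (y' + A (vsum r)) =
          a • y + b • y' + (a + b) • A (vsum r) by module, hab, one_smul] at h3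
        simp only [smul_eq_mul] at h3
        rcases ha.eq_or_lt with rfl | ha'
        · obtain rfl : b = 1 := by linarith
          linarith
        · have h4 := mul_lt_mul_of_pos_left h1 ha'
          have h5 := mul_le_mul_of_nonneg_left h2.le hb
          have h6 : a * (2 * δ) + b * (2 * δ) = 2 * δ := by rw [← add_mul, hab, one_mul]
          linarith) H) hδ
    linarith

/-- A strategy violating one of the `N` inequalities on each run could, by `exists_strat`, be
replaced by one that nearly violates a fixed inequality on all runs, beating the value of `n + 1`
moves. -/
theorem not_strat (h : IsGameValue F ξ A R) (y : Y) (N : ℕ) {ε : ℝ} (hε : 0 < ε) :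
    ¬ Strat F ξ fun r => ∃ n < N, R y (n + 1) + ε ≤ R (y + A (vsum r)) n := by
  intro H
  obtain ⟨i, hi⟩ := h.exists_strat (ι := ULift.{u} (Fin N)) (fun _ => y) (fun i => i.down)
    (fun i => h.convexOn _) (fun i => R y (i.down + 1) + ε)
    ((isStrat_strat F ξ).mono (fun r ⟨n, hn, hr⟩ => ⟨⟨⟨n, hn⟩⟩, hr⟩) H) (half_pos hε)
  linarith

theorem apply_map_le (h : IsGameValue F ξ A R) (φ : Y →ₗ[ℝ] Y) (hφ : ∀ y, ‖φ y‖ = ‖y‖)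
    (g : X →ₗ[ℝ] X) (hg : Filter.Tendsto g F F) (hgφ : ∀ x, φ (A (g x)) = A x) (y : Y) (n : ℕ) :
    R (φ y) n ≤ R y n := by
  have hQ := isStrat_strat F ξ
  refine le_of_forall_lt_imp_le_of_dense fun l hl => h.le_of_iter ?_
  refine iter_map hQ (g := g) (strat_map hg) (hQ.iter_mono (fun r hr => ?_) (h.iter_of_lt hl))
  have h1 : vsum (r.map (Prod.map id g)) = g (vsum r) := by
    simp [vsum, map_list_sum, Function.comp_def]
  rwa [h1, ← hφ, map_add, hgφ]

theorem avg_convexOn (h : IsGameValue F ξ A R) (N : ℕ) : ConvexOn ℝ Set.univ (avg R N) := by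
  have h1 : ConvexOn ℝ Set.univ fun y => ∑ n ∈ Finset.range N, R y n := by
    induction N with
    | zero => simpa using convexOn_const (0 : ℝ) convex_univ
    | succ N ih =>
      simp only [Finset.sum_range_succ]
      exact ih.add (h.convexOn N)
  exact h1.smul (by positivity)

theorem avg_lip (h : IsGameValue F ξ A R) {N : ℕ} (hN : 0 < N) (y y' : Y) :
    avg R N y ≤ avg R N y' + ‖y - y'‖ :=
  avg_le_avg hN fun n _ => h.le_add_norm_sub y y' n

theorem norm_le_avg (h : IsGameValue F ξ A R) {N : ℕ} (hN : 0 < N) (y : Y) :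
    ‖y‖ ≤ avg R N y := by
  have hN' : (0 : ℝ) < N := by exact_mod_cast hN
  have h1 := avg_le_avg (R := fun y _ => ‖y‖) (R' := R) (y := y) (y' := y) (c := 0) hN
    fun n _ => by simpa using h.norm_le_apply y n
  rw [avg, Finset.sum_const, Finset.card_range, nsmul_eq_mul, ← mul_assoc,
    one_div_mul_cancel hN'.ne'] at h1
  linarith

theorem avg_zero_le (h : IsGameValue F ξ A R) {N : ℕ} (hN : 0 < N)
    (h1 : ∀ n, 0 < n → n ≤ N → R 0 n ≤ 1) : avg R N 0 ≤ 1 := by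
  have hN' : (0 : ℝ) < N := by exact_mod_cast hN
  have h2 := avg_le_avg (R := R) (R' := fun _ _ => 1) (y := 0) (y' := 0) (c := 0) hN fun n hn => by
    rcases n.eq_zero_or_pos with rfl | hn0
    · simp [h.apply_zero]
    · simpa using h1 n hn0 hn.le
  have h3 : avg (fun (_ : Y) (_ : ℕ) => (1 : ℝ)) N 0 = 1 := by
    rw [avg, Finset.sum_const, Finset.card_range, nsmul_eq_mul, mul_one,
      one_div_mul_cancel hN'.ne']
  linarith

/-- Some move raises the average by at most about `1 / N`. -/
theorem avg_step (h : IsGameValue F ξ A R) {N : ℕ} (hN : 0 < N) (h1 : R 0 N ≤ 1) {y z : Y} {ε : ℝ}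
    (hz : ∀ n < N, R z n ≤ R y (n + 1) + ε) : avg R N z ≤ avg R N y + 1 / N + ε := by
  have hN' : (0 : ℝ) < N := by exact_mod_cast hN
  have h2 := avg_le_avg (R := R) (R' := fun y n => R y (n + 1)) hN hz
  -- Shifting the index changes the sum by `R y N - ‖y‖`, which is at most `R 0 N ≤ 1` by the
  -- Lipschitz property.
  have h3 : avg (fun y n => R y (n + 1)) N y ≤ avg R N y + 1 / N := by
    have h4 := Finset.sum_range_succ (R y) N
    rw [Finset.sum_range_succ', h.apply_zero] at h4
    have h5 := h.le_add_norm_sub y 0 N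
    rw [sub_zero] at h5
    have h6 : ∑ n ∈ Finset.range N, R y (n + 1) ≤ ∑ n ∈ Finset.range N, R y n + 1 := by linarith
    have h7 := mul_le_mul_of_nonneg_left h6 (one_div_pos.2 hN').le
    rwa [mul_add, mul_one] at h7
  linarith

end IsGameValue

end GameValues

/-! ### The weak topology on the ball, and the equivalent norm. -/

section Renorming

variable {𝕜 : Type u'} [RCLike 𝕜]
  {X : Type u} [NormedAddCommGroup X] [NormedSpace 𝕜 X]

/-- The trace on the ball of radius `σ` of the weak neighbourhoods of `0`. -/
def weakBall (𝕜 : Type u') [RCLike 𝕜] (X : Type u) [NormedAddCommGroup X] [NormedSpace 𝕜 X]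
    (σ : ℝ) : Filter X :=
  (𝓝 (0 : WeakSpace 𝕜 X)).comap (toWeakSpace 𝕜 X) ⊓ Filter.principal {x | ‖x‖ ≤ σ}

theorem frequently_weakBall {σ : ℝ} {T : Set X} (hT : ∀ x ∈ T, ‖x‖ ≤ σ)
    (h : (0 : WeakSpace 𝕜 X) ∈ closure (toWeakSpace 𝕜 X '' T)) :
    ∃ᶠ x in weakBall 𝕜 X σ, x ∈ T := by
  rw [weakBall, Filter.frequently_inf_principal, Filter.frequently_comap]
  refine (mem_closure_iff_frequently.1 h).mono ?_
  rintro _ ⟨x, hx, rfl⟩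
  exact ⟨x, rfl, hT x hx, hx⟩

theorem tendsto_smul_weakBall {σ : ℝ} {c : 𝕜} (hc : ‖c‖ = 1) :
    Filter.Tendsto (fun x : X => c • x) (weakBall 𝕜 X σ) (weakBall 𝕜 X σ) := by
  refine Filter.tendsto_inf.2 ⟨Filter.tendsto_inf_left (Filter.tendsto_comap_iff.2 ?_),
    Filter.tendsto_inf_right (Filter.tendsto_principal_principal.2 fun x hx => ?_)⟩
  · have h1 : Filter.Tendsto (fun z : WeakSpace 𝕜 X => c • z) (𝓝 0) (𝓝 0) := by
      simpa using (continuous_const_smul c).tendsto (0 : WeakSpace 𝕜 X)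
    exact h1.comp Filter.tendsto_comap
  · simpa [norm_smul, hc] using hx

theorem zero_frequently_weakBall {σ : ℝ} (hσ : 0 < σ) :
    ∃ᶠ x in weakBall 𝕜 X σ, x ∈ ({0} : Set X) := by
  refine frequently_weakBall (by simpa using hσ.le) (subset_closure ?_)
  exact ⟨0, rfl, map_zero _⟩

theorem weakBall_hasBasis {D : Set (Set X)} (hD : IsWeakNhdsBasis 𝕜 D) (σ : ℝ) :
    (weakBall 𝕜 X σ).HasBasis (· ∈ D) fun U => U ∩ {x | ‖x‖ ≤ σ} :=
  Filter.HasBasis.inf_principal hD _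

variable [NormedSpace ℝ X]

theorem norm_vsum_of_iter {ξ : Ordinal.{v}} {σ : ℝ} {n : ℕ} {Φ : List (ℝ × X) → Prop}
    (h : iter (Strat (weakBall 𝕜 X σ) ξ) n Φ) : ∃ r, Φ r ∧ ‖vsum r‖ ≤ n * σ := by
  have hQ := isStrat_strat (weakBall 𝕜 X σ) ξ
  have h1 : ∀ᶠ x in weakBall 𝕜 X σ, x ∈ {x : X | ‖x‖ ≤ σ} :=
    Filter.mem_inf_of_right (Filter.mem_principal_self _)
  obtain ⟨r, ⟨hr, hval⟩, hel⟩ := hQ.iter_exists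
    (iter_eventually hQ (fun h => strat_eventually h1 h) (hQ.iter_valid h))
  exact ⟨r, hr, norm_vsum_le hval hel⟩

variable {Y : Type u''} [NormedAddCommGroup Y] [NormedSpace 𝕜 Y]

/-- Every initial segment of the branch lies on exactly one level, so summing over the levels gives
the sum over the whole run. -/
theorem sum_block (A : X →ₗ[𝕜] Y) {ξ : Ordinal.{v}} {D : Set (Set X)} {n : ℕ}
    (x : List (Ordinal.{v} × Set X) → X) {t : List (Ordinal.{v} × Set X)} (ht : t ∈ Om ξ D n) :
    ∑ i ∈ Finset.Icc 1 n, A (block ξ n x t i) =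
      A (vsum (branchRun (fun u => weight ξ (iota ξ (u.map Prod.fst))) x t)) := by
  classical
  have hG := gam_isTreeBelow ξ
  rw [← map_sum]
  congr 1
  have h1 : vsum (branchRun (fun u => weight ξ (iota ξ (u.map Prod.fst))) x t) =
      ∑ k ∈ Finset.range t.length,
        weight ξ (iota ξ ((t.take (k + 1)).map Prod.fst)) • x (t.take (k + 1)) := by
    rw [vsum, branchRun, List.map_map]
    rfl
  rw [h1]
  simp only [block, Finset.sum_filter]
  rw [Finset.sum_comm]
  refine Finset.sum_congr rfl fun k hk => ?_
  rw [Finset.mem_range] at hk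
  have hne : (t.take (k + 1)).map Prod.fst ≠ [] := by
    rw [← List.length_pos_iff, List.length_map, List.length_take]
    omega
  have hmem : ((t.take (k + 1)).map Prod.fst).getLast hne ∈ t.map Prod.fst :=
    ((List.take_prefix (k + 1) t).map Prod.fst).subset (List.getLast_mem hne)
  obtain ⟨j, hj, he⟩ := hG.levels_div ht.1 hmem
  rw [List.getLastD_eq_getLast?, List.getLast?_eq_some_getLast hne, Option.getD_some, he,
    Finset.sum_eq_single (n - j)]
  · rw [if_pos]
    congr 1
    omega
  · intro i hi hij
    rw [Finset.mem_Icc] at hi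
    rw [if_neg]
    intro h
    have : j = n - i := by exact_mod_cast h
    omega
  · intro h
    rw [Finset.mem_Icc] at h
    omega

theorem iter_iff_exists_collection {D : Set (Set X)} (hD : IsWeakNhdsBasis 𝕜 D) (ξ : Ordinal.{v})
    (σ : ℝ) (A : X →L[𝕜] Y) (n : ℕ) (P : Y → Prop) :
    iter (Strat (weakBall 𝕜 X σ) ξ) (n + 1) (fun r => P (A (vsum r))) ↔
      ∃ x : List (Ordinal.{v} × Set X) → X, IsNormallyWeaklyNull ξ D (n + 1) x ∧
        (∀ t ∈ Om ξ D (n + 1), ‖x t‖ ≤ σ) ∧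
        ∀ t ∈ maxElems (Om ξ D (n + 1)), P (∑ i ∈ Finset.Icc 1 (n + 1), A (block ξ (n + 1) x t i)) := by
  have hB := weakBall_hasBasis hD σ
  rw [← hasCollection_gamN hB.ex_mem (hasCollection_gam hB ξ)]
  refine exists_congr fun x => and_congr Iff.rfl (and_congr Iff.rfl (forall₂_congr fun t ht => ?_))
  exact iff_of_eq (congrArg P (sum_block (A : X →ₗ[𝕜] Y) x ht.1).symm)

variable [IsScalarTower ℝ 𝕜 X] [NormedSpace ℝ Y] [IsScalarTower ℝ 𝕜 Y]

theorem isGameValue_varrho {D : Set (Set X)} (hD : IsWeakNhdsBasis 𝕜 D) (ξ : Ordinal.{v})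
    (A : X →L[𝕜] Y) (hA : ‖A‖ ≤ 1) {σ : ℝ} (hσ : 0 < σ) (hσ1 : σ ≤ 1) :
    IsGameValue (weakBall 𝕜 X σ) ξ ((A : X →ₗ[𝕜] Y).restrictScalars ℝ)
      (fun y n => varrho ξ σ A D y n) := by
  have hnorm : ∀ x, ‖A x‖ ≤ ‖x‖ := fun x => A.le_of_opNorm_le hA x |>.trans (one_mul _).le
  have hQ := isStrat_strat (weakBall 𝕜 X σ) ξ
  have hzero := zero_frequently_weakBall (𝕜 := 𝕜) (X := X) hσ
  have hS : ∀ (y : Y) (n : ℕ) (l : ℝ), l ∈ {l : ℝ | ∀ x : List (Ordinal.{v} × Set X) → X,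
      IsNormallyWeaklyNull ξ D (n + 1) x → (∀ t ∈ Om ξ D (n + 1), ‖x t‖ ≤ σ) →
      ∃ t ∈ maxElems (Om ξ D (n + 1)),
        ‖y + ∑ i ∈ Finset.Icc 1 (n + 1), A (block ξ (n + 1) x t i)‖ ≤ l} ↔
      ¬ iter (Strat (weakBall 𝕜 X σ) ξ) (n + 1) fun r => l < ‖y + A (vsum r)‖ := by
    intro y n l
    rw [iter_iff_exists_collection hD ξ σ A n fun z => l < ‖y + z‖]
    push Not
    rfl
  refine ⟨hnorm, Filter.mem_inf_of_right fun x (hx : ‖x‖ ≤ σ) => hx.trans hσ1, hzero, ?_, ?_⟩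
  · intro y n l hl
    rcases n with _ | n
    · simpa [varrho, iter] using hl
    · simp only [varrho, n.succ_ne_zero, if_false] at hl
      -- The infimum is that of a real set, so bounds are needed: the zero collection gives the
      -- lower bound `‖y‖`, and below, `‖y‖ + (n + 1) * σ` shows that the set is non-empty.
      have h1 := notMem_of_lt_csInf hl ⟨‖y‖, fun s hs => by
        by_contra! hlt
        refine (hS y n s).1 hs (hQ.iter_mono (fun r hr => ?_)
          (iter_frequently hQ (strat_frequently hzero ξ) (n + 1)))
        rwa [vsum_eq_zero hr, map_zero, add_zero]⟩
      rw [hS, not_not] at h1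
      exact h1
  · intro y n l hl
    rcases n with _ | n
    · simpa [varrho, iter] using hl.le
    · simp only [varrho, n.succ_ne_zero, if_false]
      refine le_csInf ⟨‖y‖ + (n + 1 : ℕ) * σ, (hS y n _).2 fun h => ?_⟩ fun s hs => ?_
      · obtain ⟨r, hr, hr'⟩ := norm_vsum_of_iter h
        have h1 := norm_add_le y (A (vsum r))
        linarith [hnorm (vsum r)]
      · by_contra! hlt
        exact (hS y n s).1 hs (hQ.iter_mono (fun r hr => hlt.trans hr) hl)

/-- The norm is the gauge of `C = {f ≤ 2}`. As `f` is `1`-Lipschitz with `f 0 ≤ 1` and `‖y‖ ≤ f y`,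
`C` lies between the balls of radius `1` and `2`, which gives the equivalence constants. -/
theorem exists_seminorm {D : Set (Set X)} (hD : IsWeakNhdsBasis 𝕜 D) (ξ : Ordinal.{v})
    (A : X →L[𝕜] Y) (hA : ‖A‖ ≤ 1) {σ : ℝ} (hσ : 0 < σ) (hσ1 : σ ≤ 1) {N : ℕ} (hN : 0 < N)
    (h1 : ∀ n, 0 < n → n ≤ N → varrho ξ σ A D 0 n ≤ 1) :
    ∃ p : Seminorm 𝕜 Y, IsTwoEquivalentNorm p ∧
      {y : Y | p y ≤ 1} =
        {y : Y | (1 / (N : ℝ)) * ∑ n ∈ Finset.range N, varrho ξ σ A D y n ≤ 2} ∧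
      rho.{u, v, w} ξ σ A p ≤ ((1 / (N : ℝ) : ℝ) : EReal) := by
  have hR := isGameValue_varrho hD ξ A hA hσ hσ1
  set R : Y → ℕ → ℝ := fun y n => varrho ξ σ A D y n with hRdef
  have hN' : (0 : ℝ) < N := by exact_mod_cast hN
  set f : Y → ℝ := avg R N with hf
  set C : Set Y := {y | f y ≤ 2} with hCdef
  have hf0 : f 0 ≤ 1 := hR.avg_zero_le hN h1
  have hfconv : ConvexOn ℝ Set.univ f := hR.avg_convexOn N
  have hflip : ∀ y y', f y ≤ f y' + ‖y - y'‖ := hR.avg_lip hN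
  have hC : Convex ℝ C := by
    have := hfconv.convex_le 2
    simpa using this
  have hscale : ∀ (a : ℝ) (y : Y), 0 ≤ a → a ≤ 1 → f (a • y) ≤ a * f y + (1 - a) := by
    intro a y ha ha1
    have h2 := hfconv.2 (Set.mem_univ y) (Set.mem_univ 0) ha (sub_nonneg.2 ha1) (by ring)
    rw [smul_zero, add_zero, smul_eq_mul, smul_eq_mul] at h2
    have h3 := mul_le_mul_of_nonneg_left hf0 (sub_nonneg.2 ha1)
    linarith
  have hrot : ∀ (c : 𝕜) (y : Y), ‖c‖ = 1 → f (c • y) ≤ f y := by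
    intro c y hc
    have hc0 : c ≠ 0 := fun h => by simp [h] at hc
    have h2 := avg_le_avg (R := R) (R' := R) (y := c • y) (y' := y) (c := 0) hN fun n _ => by
      rw [add_zero]
      refine hR.apply_map_le ((LinearMap.lsmul 𝕜 Y c).restrictScalars ℝ)
        (fun y => by simp [norm_smul, hc]) ((LinearMap.lsmul 𝕜 X c⁻¹).restrictScalars ℝ)
        (tendsto_smul_weakBall (by simp [hc])) (fun x => ?_) y n
      simp [smul_smul, hc0]
    simpa using h2
  have hbal : Balanced 𝕜 C := by
    refine balanced_iff_smul_mem.2 fun c hc y (hy : f y ≤ 2) => ?_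
    change f (c • y) ≤ 2
    rcases eq_or_ne c 0 with rfl | hc0
    · rw [zero_smul]
      linarith
    · have hcn : ‖c‖ ≠ 0 := norm_ne_zero_iff.2 hc0
      -- Polar decomposition: the unimodular factor does not increase `f`, and contraction by `‖c‖ ≤
      -- 1` preserves `f ≤ 2`.
      have h2 : c • y = ‖c‖ • (((‖c‖⁻¹ : ℝ) • c) • y) := by
        rw [smul_assoc, smul_smul, mul_inv_cancel₀ hcn, one_smul]
      rw [h2]
      have h3 := hscale ‖c‖ (((‖c‖⁻¹ : ℝ) • c) • y) (norm_nonneg _) hc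
      have h4 := hrot ((‖c‖⁻¹ : ℝ) • c) y (by
        rw [norm_smul, norm_inv, norm_norm, inv_mul_cancel₀ hcn])
      nlinarith [norm_nonneg c]
  have hball : Metric.ball (0 : Y) 1 ⊆ C := by
    intro y hy
    rw [mem_ball_zero_iff] at hy
    have := hflip y 0
    rw [sub_zero] at this
    change f y ≤ 2
    linarith
  have hnhds : C ∈ 𝓝 (0 : Y) := Filter.mem_of_superset (Metric.ball_mem_nhds _ one_pos) hball
  have habs : Absorbent ℝ C := absorbent_nhds_zero hnhds
  have hclosed : IsClosed C := by
    have hcont : Continuous f := by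
      refine LipschitzWith.continuous (K := 1) (LipschitzWith.of_le_add fun x y => ?_)
      rw [dist_eq_norm]
      exact hflip x y
    exact isClosed_le hcont continuous_const
  let p : Seminorm 𝕜 Y := gaugeSeminorm hbal hC habs
  have hp : ∀ y, p y = gauge C y := fun y => rfl
  have hunit : ∀ y, p y ≤ 1 ↔ f y ≤ 2 := by
    intro y
    rw [hp, gauge_le_one_iff_mem_closure hC hnhds, hclosed.closure_eq]
    rfl
  refine ⟨p, fun y => ⟨?_, ?_⟩, Set.ext hunit, ?_⟩
  · simpa [hp] using mul_gauge_le_norm (x := y) hball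
  · have h2 : C ⊆ Metric.closedBall 0 2 := fun z (hz : f z ≤ 2) => by
      rw [mem_closedBall_zero_iff]
      exact (hR.norm_le_avg hN z).trans hz
    have h3 := le_gauge_of_subset_closedBall habs zero_le_two h2 (x := y)
    rw [hp]
    linarith
  · refine iSup_le fun y => iSup_le fun hy => iSup_le fun Λ => iSup_le fun B => iSup_le fun hB =>
      iSup_le fun ho => iSup_le fun x => iSup_le fun hx => iSup_le fun hnull => ?_
    by_contra! hlt
    obtain ⟨c, hc1, hc2⟩ := EReal.lt_iff_exists_real_btwn.1 hlt
    rw [EReal.coe_lt_coe_iff] at hc1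
    have hc0 : 0 < c := (one_div_pos.2 hN').trans hc1
    have hbig : ∀ t ∈ B, ∀ z ∈ convexHull ℝ (x '' {s | s ∈ B ∧ s <+: t}),
        2 + c < f (y + A z) := by
      intro t ht z hz
      have h2 : (c : EReal) < ((p (y + A z) - 1 : ℝ) : EReal) :=
        hc2.trans_le (iInf₂_le_of_le t ht (iInf₂_le z hz))
      rw [EReal.coe_lt_coe_iff] at h2
      by_contra! hle
      -- If `f` were at most `2 + c`, contracting by `1 + c` towards `0`, where `f ≤ 1`, would bring
      -- it down to exactly `2`, so the gauge would be at most `1 + c`.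
      have h3 := hscale (1 + c)⁻¹ (y + A z) (by positivity) (inv_le_one_of_one_le₀ (by linarith))
      have h4 : (1 + c)⁻¹ * f (y + A z) ≤ (1 + c)⁻¹ * (2 + c) :=
        mul_le_mul_of_nonneg_left hle (by positivity)
      have h5 : (1 + c)⁻¹ * (2 + c) + (1 - (1 + c)⁻¹) = 2 := by
        field_simp
        ring
      have h6 : (1 + c)⁻¹ • (y + A z) ∈ C := by
        change f _ ≤ 2
        linarith
      have h7 := gauge_le_of_mem (a := 1 + c) (by linarith) ((Set.mem_smul_set_iff_inv_smul_mem₀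
        (by linarith) C (y + A z)).2 h6)
      rw [← hp] at h7
      linarith
    -- With slack `ε = c - 1 / N`, a run satisfying all `N` inequalities would have `f (y + Az) ≤ f
    -- y + c ≤ 2 + c`.
    refine hR.not_strat y N (sub_pos.2 hc1) ((isStrat_strat _ ξ).mono (fun r hr => ?_)
      ((isStrat_strat _ ξ).valid (strat_of_tree hB ho fun α t ht => frequently_weakBall ?_
        (hnull α t ht))))
    · obtain ⟨⟨t, ht, hr⟩, hval⟩ := hr
      have h2 := hbig t ht (vsum r) (convexHull_mono hr (vsum_mem_convexHull hval))
      by_contra! hcon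
      have h3 := hR.avg_step hN (h1 N hN le_rfl) (y := y) (z := y + A (vsum r))
        fun n hn => (hcon n hn).le
      have h4 := (hunit y).1 hy
      change f (y + A (vsum r)) ≤ f y + _ + _ at h3
      linarith
    · rintro _ ⟨s, ⟨hs, -⟩, rfl⟩
      exact hx s (deriv_subset B α hs)

end Renorming

end XiAUS

end

/-! ### The theorem: the definition of `N_ξ(σ)` supplies the bound on the values at `0`. -/

open XiAUS in
theorem mainTheorem7 {𝕜 : Type u'} [RCLike 𝕜]
    {X : Type u} [NormedAddCommGroup X] [NormedSpace 𝕜 X] [CompleteSpace X]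
    [NormedSpace ℝ X] [IsScalarTower ℝ 𝕜 X]
    {Y : Type u''} [NormedAddCommGroup Y] [NormedSpace 𝕜 Y] [CompleteSpace Y]
    (D : Set (Set X)) (hD : XiAUS.IsWeakNhdsBasis 𝕜 D)
    (ξ : Ordinal.{v}) (A : X →L[𝕜] Y) (hA : ‖A‖ ≤ 1) (σ : ℝ) (hσ : 0 < σ) (hσ1 : σ ≤ 1) :
    (∀ N : ℕ, XiAUS.enN ξ σ A D = (N : ℕ∞) →
      0 < N ∧
      ∃ p : Seminorm 𝕜 Y, XiAUS.IsTwoEquivalentNorm p ∧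
        {y : Y | p y ≤ 1} =
          {y : Y | (1 / (N : ℝ)) * ∑ n ∈ Finset.range N, XiAUS.varrho ξ σ A D y n ≤ 2} ∧
        XiAUS.rho.{u, v, w} ξ σ A p ≤ ((1 / (N : ℝ) : ℝ) : EReal)) ∧
    (XiAUS.enN ξ σ A D = ⊤ →
      ∀ N : ℕ, 0 < N →
      ∃ p : Seminorm 𝕜 Y, XiAUS.IsTwoEquivalentNorm p ∧
        {y : Y | p y ≤ 1} =
          {y : Y | (1 / (N : ℝ)) * ∑ n ∈ Finset.range N, XiAUS.varrho ξ σ A D y n ≤ 2} ∧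
        XiAUS.rho.{u, v, w} ξ σ A p ≤ ((1 / (N : ℝ) : ℝ) : EReal)) := by
  let : NormedSpace ℝ Y := NormedSpace.restrictScalars ℝ 𝕜 Y
  have : IsScalarTower ℝ 𝕜 Y := inferInstance
  have hR := isGameValue_varrho hD ξ A hA hσ hσ1
  -- A value above `1` at `0` for `n + 1` moves is witnessed by a collection with `n + 1` levels,
  -- which forces `N_ξ(σ) ≤ n`.
  have hle : ∀ N : ℕ, (N : ℕ∞) ≤ enN ξ σ A D → ∀ n, 0 < n → n ≤ N →
      varrho ξ σ A D 0 n ≤ 1 := by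
    intro N hN n hn hnN
    obtain ⟨n, rfl⟩ := Nat.exists_eq_succ_of_ne_zero hn.ne'
    by_contra! hlt
    have h1 := hR.iter_of_lt hlt
    simp only [zero_add] at h1
    have h2 : enN ξ σ A D ≤ (n : ℕ∞) := iInf₂_le n
      ((iter_iff_exists_collection hD ξ σ A n fun z => 1 < ‖z‖).1 h1)
    have h3 : N ≤ n := by exact_mod_cast hN.trans h2
    omega
  refine ⟨fun N hN => ?_, fun htop N hN =>
    exists_seminorm hD ξ A hA hσ hσ1 hN (hle N (by rw [htop]; exact le_top))⟩
  have hpos : 0 < N := by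
    by_contra! h0
    obtain rfl : N = 0 := by omega
    have h1 : enN ξ σ A D < 1 := by rw [hN]; simp
    simp only [enN, iInf_lt_iff] at h1
    obtain ⟨n, hx, hn⟩ := h1
    obtain rfl : n = 0 := by
      have : n < 1 := by exact_mod_cast hn
      omega
    -- A single level yields a convex combination of vectors of norm at most `σ ≤ 1`, whose image
    -- cannot have norm above `1`.
    have h2 := (iter_iff_exists_collection hD ξ σ A 0 fun z => 1 < ‖z‖).2 hx
    obtain ⟨r, hr, hr'⟩ := norm_vsum_of_iter h2
    have h3 := A.le_of_opNorm_le hA (vsum r)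
    simp only [zero_add, Nat.cast_one, one_mul] at hr' h3
    linarith
  exact ⟨hpos, exists_seminorm hD ξ A hA hσ hσ1 hpos (hle N hN.ge)⟩
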